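/- Let $k$ be an algebraically closed field of characteristic $p>0$, let $V$ be a finite-dimensional $k$-vector space, and let $G\subset \operatorname{GL}(V)$ be a finite subgroup whose order is not divisible by $p$ and which contains no pseudo-reflections (no $g\in G$ such that $g-1$ has rank one on $V$). Let $S=\operatorname{Sym}_k V$, with the action of $G$ by $k$-algebra automorphisms that extends its action on $V$, and let $R=S^G$. A $(G,S)$-module is an $S$-module $M$ with an additive action of $G$ such that $g(sm)=(gs)(gm)$ for $g\in G$, $s\in S$, $m\in M$; morphisms are the $G$-equivariant $S$-linear maps. For a $(G,S)$-module $M$, the dual $M^*=\operatorname{Hom}_S(M,S)$ is a $(G,S)$-module by $(g\varphi)(m)=g(\varphi(g^{-1}m))$. Let $\operatorname{Ref}(G,S)$ be the full subcategory of the $(G,S)$-modules $M$ that are finitely generated over $S$ and for which the canonical map $M\to M^{**}$ is bijective, and let $\operatorname{Ref}(R)$ be the category of finitely generated reflexive $R$-modules. For an $R$-module $N$, $G$ acts on $S\otimes_R N$ by $g(s\otimes n)=gs\otimes n$. Then $M\mapsto M^G$ defines a functor $\operatorname{Ref}(G,S)\to\operatorname{Ref}(R)$ which is an equivalence of categories,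 and $N\mapsto (S\otimes_R N)^{**}$ (with $(-)^*=\operatorname{Hom}_S(-,S)$) defines a functor $\operatorname{Ref}(R)\to\operatorname{Ref}(G,S)$ which is a quasi-inverse. Give $S$ its standard grading ($V$ in degree $1$), regarded as a $\mathbb{Z}[1/p]$-grading, and $R$ the induced grading. Let ${}^*\operatorname{Ref}(G,S)$ be the category of $\mathbb{Z}[1/p]$-graded $(G,S)$-modules $M=\bigoplus_a M_a$ (with $S_cM_a\subset M_{c+a}$ and $gM_a\subset M_a$ for $g\in G$) whose underlying $(G,S)$-module lies in $\operatorname{Ref}(G,S)$, and let ${}^*\operatorname{Ref}(R)$ be the category of $\mathbb{Z}[1/p]$-graded $R$-modules whose underlying module lies in $\operatorname{Ref}(R)$; morphisms preserve degrees. Then the same functors, with the induced gradings $(M^G)_a=M^G\cap M_a$, $(S\otimes_R N)_a=\sum_{c+b=a}S_c\otimes N_b$ (the additive subgroup generated by the $s\otimes n$ with $s\in S_c$, $n\in N_b$, $c+b=a$) and $(M^*)_a=\{\varphi\mid \varphi(M_b)\subset S_{a+b}\text{ for all }b\}$, are equivalences ${}^*\operatorname{Ref}(G,S)\to{}^*\operatorname{Ref}(R)$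 and ${}^*\operatorname{Ref}(R)\to{}^*\operatorname{Ref}(G,S)$, quasi-inverse to each other. -/

import Mathlib

open CategoryTheory
open scoped TensorProduct

universe u v

noncomputable section

/-! ### The group action on the symmetric algebra -/

namespace SymmetricAlgebra

variable (k : Type u) (V : Type v) [Field k] [AddCommGroup V] [Module k V]

/-- `GL(V)` acts on `Sym V` by the `k`-algebra automorphisms extending its action on `V`. -/
instance glAction :
    MulSemiringAction (LinearMap.GeneralLinearGroup k V) (SymmetricAlgebra k V) where
  smul g s := SymmetricAlgebra.lift (SymmetricAlgebra.ι k V ∘ₗ (g : V →ₗ[k] V)) s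
  one_smul s := by
    change SymmetricAlgebra.lift (SymmetricAlgebra.ι k V ∘ₗ (LinearMap.id : V →ₗ[k] V)) s = s
    rw [LinearMap.comp_id, SymmetricAlgebra.lift_ι]
    rfl
  mul_smul g h s := by
    have : SymmetricAlgebra.lift (SymmetricAlgebra.ι k V ∘ₗ ((g * h :
          LinearMap.GeneralLinearGroup k V) : V →ₗ[k] V)) =
        (SymmetricAlgebra.lift (SymmetricAlgebra.ι k V ∘ₗ (g : V →ₗ[k] V))).comp
          (SymmetricAlgebra.lift (SymmetricAlgebra.ι k V ∘ₗ (h : V →ₗ[k] V))) := by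
      apply SymmetricAlgebra.algHom_ext
      ext x
      simp
    exact congrArg (fun f => f s) this
  smul_zero _ := map_zero _
  smul_add _ := map_add _
  smul_one _ := map_one _
  smul_mul _ := map_mul _

/-- The standard grading of `Sym V`, with `V` in degree `1`, indexed by a ring `Γ` through
`ℕ → Γ`: the component of degree `c` is `Symⁱ V` if `c = i` for some natural number `i`
(`Γ` being of characteristic zero), and zero if `c` is not a natural number. -/
def grading (Γ : Type*) [Ring Γ] (c : Γ) : AddSubgroup (SymmetricAlgebra k V) :=
  ⨆ (i : ℕ) (_ : (i : Γ) = c), ((LinearMap.range (SymmetricAlgebra.ι k V)) ^ i).toAddSubgroup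

end SymmetricAlgebra

/-- A pseudo-reflection of `V`: an automorphism `g` such that `g - 1` has rank one, that is, the
fixed space of `g` is a hyperplane. -/
def IsPseudoReflection {k : Type u} {V : Type v} [Field k] [AddCommGroup V] [Module k V]
    (g : LinearMap.GeneralLinearGroup k V) : Prop :=
  Module.finrank k (LinearMap.range ((g : V →ₗ[k] V) - LinearMap.id)) = 1

/-! ### `(G, S)`-modules -/

/-- A `(G, S)`-module: an `S`-module with an additive action of `G` such that
`g (s m) = (g s) (g m)`. -/
structure GSModule (G : Type v) (S : Type u) [Group G] [CommRing S] [MulSemiringAction G S] where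
  carrier : Type u
  [addCommGroup : AddCommGroup carrier]
  [module : Module S carrier]
  [action : DistribMulAction G carrier]
  smul_smul' : ∀ (g : G) (s : S) (m : carrier), g • (s • m) = (g • s) • (g • m)

namespace GSModule

attribute [instance] addCommGroup module action

variable {G : Type v} {S : Type u} [Group G] [CommRing S] [MulSemiringAction G S]

instance : CoeSort (GSModule G S) (Type u) := ⟨GSModule.carrier⟩

/-- Morphisms of `(G, S)`-modules: the `G`-equivariant `S`-linear maps. -/
@[ext]
structure Hom (M N : GSModule G S) where
  toLin : M →ₗ[S] N
  map_act : ∀ (g : G) (m : M), toLin (g • m) = g • toLin m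

instance : Category (GSModule G S) where
  Hom M N := Hom M N
  id M := ⟨LinearMap.id, fun _ _ => rfl⟩
  comp f f' := ⟨f'.toLin ∘ₗ f.toLin, fun g m => by simp [f.map_act, f'.map_act]⟩

@[simp] lemma id_toLin (M : GSModule G S) : Hom.toLin (𝟙 M) = LinearMap.id := rfl

@[simp] lemma comp_toLin {M N P : GSModule G S} (f : M ⟶ N) (f' : N ⟶ P) :
    Hom.toLin (f ≫ f') = Hom.toLin f' ∘ₗ Hom.toLin f := rfl

@[ext] lemma hom_ext {M N : GSModule G S} {f f' : M ⟶ N} (h : Hom.toLin f = Hom.toLin f') :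
    f = f' := Hom.ext h

variable (G S) in
/-- Reflexive `(G, S)`-modules: those that are finitely generated over `S` and for which the
canonical map `M → M**` is bijective. -/
def reflexive : ObjectProperty (GSModule G S) :=
  fun M => Module.Finite S M ∧ Module.IsReflexive S M

/-! #### Invariants -/

/-- The `S^G`-submodule `M^G` of invariants of `M`. -/
def fixed (M : GSModule G S) : Submodule (FixedPoints.subring S G) M where
  carrier := {m | ∀ g : G, g • m = m}
  add_mem' ha hb g := by rw [smul_add, ha g, hb g]
  zero_mem' g := smul_zero g
  smul_mem' r m hm g := by
    change g • ((r : S) • m) = (r : S) • m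
    rw [M.smul_smul', hm g, show g • (r : S) = r from r.2 g]

/-- The map `M^G → N^G` induced by a morphism `M → N`. -/
def fixedMap {M N : GSModule G S} (f : M ⟶ N) :
    M.fixed →ₗ[FixedPoints.subring S G] N.fixed where
  toFun m := ⟨Hom.toLin f m.1, fun g => by rw [← Hom.map_act, m.2 g]⟩
  map_add' a b := Subtype.ext (map_add (Hom.toLin f) a.1 b.1)
  map_smul' r a := Subtype.ext (map_smul (Hom.toLin f) (r : S) a.1)

variable (G S) in
/-- The functor `M ↦ M^G` from `(G, S)`-modules to `S^G`-modules. -/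
def invariants : GSModule G S ⥤ ModuleCat.{u} (FixedPoints.subring S G) where
  obj M := ModuleCat.of _ M.fixed
  map f := ModuleCat.ofHom (fixedMap f)
  map_id _ := rfl
  map_comp _ _ := rfl

/-! #### Duals -/

/-- The dual `M* = Hom_S(M, S)` of a `(G, S)`-module, with the action `(g φ)(m) = g (φ (g⁻¹ m))`. -/
def dual (M : GSModule G S) : GSModule G S :=
  letI act : DistribMulAction G (Module.Dual S M) :=
    { smul := fun g φ =>
        { toFun := fun m => g • φ (g⁻¹ • m)
          map_add' := fun a b => by simp
          map_smul' := fun s a => by simp [M.smul_smul'] }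
      one_smul := fun φ => LinearMap.ext fun m => by
        change (1 : G) • φ ((1 : G)⁻¹ • m) = φ m
        simp
      mul_smul := fun g h φ => LinearMap.ext fun m => by
        change (g * h) • φ ((g * h)⁻¹ • m) = g • h • φ (h⁻¹ • g⁻¹ • m)
        simp [mul_smul]
      smul_zero := fun g => LinearMap.ext fun m => by
        change g • (0 : S) = 0
        simp
      smul_add := fun g φ ψ => LinearMap.ext fun m => by
        change g • (φ (g⁻¹ • m) + ψ (g⁻¹ • m)) = g • φ (g⁻¹ • m) + g • ψ (g⁻¹ • m)
        simp }
  { carrier := Module.Dual S M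
    smul_smul' := fun g s φ => LinearMap.ext fun m => by
      change g • (s * φ (g⁻¹ • m)) = (g • s) * (g • φ (g⁻¹ • m))
      simp }

lemma dual_smul_apply (M : GSModule G S) (g : G) (φ : Module.Dual S M) (m : M) :
    (show Module.Dual S M from g • (show M.dual from φ)) m = g • φ (g⁻¹ • m) := rfl

/-- The transpose `N* → M*` of a morphism `M → N`. -/
def dualMap {M N : GSModule G S} (f : M ⟶ N) : N.dual ⟶ M.dual where
  toLin := (Hom.toLin f).dualMap
  map_act g φ := LinearMap.ext fun m => by
    change g • (show Module.Dual S N from φ) (g⁻¹ • Hom.toLin f m) =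
      g • (show Module.Dual S N from φ) (Hom.toLin f (g⁻¹ • m))
    rw [Hom.map_act]

variable (G S) in
/-- The functor `M ↦ M**`. -/
def doubleDual : GSModule G S ⥤ GSModule G S where
  obj M := M.dual.dual
  map f := dualMap (dualMap f)
  map_id _ := rfl
  map_comp _ _ := rfl

/-! #### Extension of scalars -/

instance fixedPoints_smulCommClass : SMulCommClass (FixedPoints.subring S G) G S :=
  SMulCommClass.symm _ _ _

/-- The `(G, S)`-module `S ⊗_R N` for an `R`-module `N`, where `R = S^G`; the action is
`g (s ⊗ n) = (g s) ⊗ n`. -/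
def baseChange (N : ModuleCat.{u} (FixedPoints.subring S G)) : GSModule G S where
  carrier := S ⊗[FixedPoints.subring S G] N
  action := TensorProduct.leftDistribMulAction
  smul_smul' g s x := by
    induction x using TensorProduct.induction_on with
    | zero => simp only [smul_zero]
    | tmul s' n => simp only [TensorProduct.smul_tmul', smul_eq_mul, smul_mul']
    | add a b ha hb => simp only [smul_add, ha, hb]

/-- The map `S ⊗_R N → S ⊗_R N'` induced by an `R`-linear map `N → N'`. -/
def baseChangeMap {N N' : ModuleCat.{u} (FixedPoints.subring S G)} (f : N ⟶ N') :
    baseChange N ⟶ baseChange N' where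
  toLin := LinearMap.baseChange S f.hom
  map_act g x := by
    change S ⊗[FixedPoints.subring S G] N at x
    change LinearMap.baseChange S f.hom (g • x) = g • LinearMap.baseChange S f.hom x
    induction x using TensorProduct.induction_on with
    | zero => simp only [smul_zero, map_zero]
    | tmul s' n => simp only [TensorProduct.smul_tmul', LinearMap.baseChange_tmul]
    | add a b ha hb => simp only [smul_add, map_add, ha, hb]

variable (G S) in
/-- The functor `N ↦ S ⊗_R N` from `R`-modules to `(G, S)`-modules, where `R = S^G`. -/
def extension : ModuleCat.{u} (FixedPoints.subring S G) ⥤ GSModule G S where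
  obj N := baseChange N
  map f := baseChangeMap f
  map_id _ := hom_ext (LinearMap.baseChange_id)
  map_comp f f' := hom_ext (LinearMap.baseChange_comp (f := f.hom) f'.hom)

end GSModule

/-- Reflexive modules over a commutative ring `R`: those that are finitely generated and for which
the canonical map `N → N**` is bijective. -/
def reflexiveModules (R : Type u) [CommRing R] : ObjectProperty (ModuleCat.{u} R) :=
  fun N => Module.Finite R N ∧ Module.IsReflexive R N

/-! ### Graded modules

The graded categories are introduced as full subcategories (`IsGradedReflexive` below) of the
categories of modules with an arbitrary family of additive subgroups, so that the functors can be
written down before it is known that they preserve gradings. -/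

/-- A module over the commutative ring `R` with a family of additive subgroups indexed by `Γ`. -/
structure FamModule (R : Type u) [CommRing R] (Γ : Type*) where
  mod : ModuleCat.{u} R
  gr : Γ → AddSubgroup mod

namespace FamModule

variable {R : Type u} [CommRing R] {Γ : Type*}

/-- Morphisms: the `R`-linear maps that preserve degrees. -/
@[ext]
structure Hom (M N : FamModule R Γ) where
  hom : M.mod ⟶ N.mod
  map_gr : ∀ (a : Γ), ∀ m ∈ M.gr a, hom m ∈ N.gr a

instance : Category (FamModule R Γ) where
  Hom M N := Hom M N
  id M := ⟨𝟙 _, fun _ _ hm => hm⟩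
  comp f f' := ⟨f.hom ≫ f'.hom, fun a _ hm => f'.map_gr a _ (f.map_gr a _ hm)⟩

open scoped Classical in
/-- Graded reflexive modules over a ring `R` graded by `𝓡`: the given family is a grading of the
module (`N = ⨁ N_a` and `R_c N_a ⊆ N_{c + a}`), and the module is reflexive. -/
def gradedReflexive [AddMonoid Γ] (𝓡 : Γ → AddSubgroup R) : ObjectProperty (FamModule R Γ) :=
  fun N => DirectSum.IsInternal N.gr ∧ SetLike.GradedSMul 𝓡 N.gr ∧ reflexiveModules R N.mod

end FamModule

/-- A `(G, S)`-module with a family of additive subgroups indexed by `Γ`. -/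
structure FamGSModule (G : Type v) (S : Type u) [Group G] [CommRing S] [MulSemiringAction G S]
    (Γ : Type*) where
  mod : GSModule G S
  gr : Γ → AddSubgroup mod

namespace FamGSModule

variable {G : Type v} {S : Type u} [Group G] [CommRing S] [MulSemiringAction G S] {Γ : Type*}

/-- Morphisms: the `G`-equivariant `S`-linear maps that preserve degrees. -/
@[ext]
structure Hom (M N : FamGSModule G S Γ) where
  hom : M.mod ⟶ N.mod
  map_gr : ∀ (a : Γ), ∀ m ∈ M.gr a, GSModule.Hom.toLin hom m ∈ N.gr a

instance : Category (FamGSModule G S Γ) where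
  Hom M N := Hom M N
  id M := ⟨𝟙 _, fun _ _ hm => hm⟩
  comp f f' := ⟨f.hom ≫ f'.hom, fun a _ hm => f'.map_gr a _ (f.map_gr a _ hm)⟩

open scoped Classical in
/-- Graded reflexive `(G, S)`-modules, where `S` is graded by `𝓢`: the given family is a grading of
the `(G, S)`-module (`M = ⨁ M_a`, `S_c M_a ⊆ M_{c + a}` and `g M_a ⊆ M_a`), and the module is
reflexive. -/
def gradedReflexive [AddMonoid Γ] (𝓢 : Γ → AddSubgroup S) : ObjectProperty (FamGSModule G S Γ) :=
  fun M => DirectSum.IsInternal M.gr ∧ SetLike.GradedSMul 𝓢 M.gr ∧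
    (∀ (g : G) (a : Γ), ∀ m ∈ M.gr a, g • m ∈ M.gr a) ∧ GSModule.reflexive G S M.mod

variable (G S Γ) in
/-- The functor `M ↦ M^G`, with `(M^G)_a = M^G ∩ M_a`. -/
def invariants : FamGSModule G S Γ ⥤ FamModule (FixedPoints.subring S G) Γ where
  obj M :=
    { mod := (GSModule.invariants G S).obj M.mod
      gr := fun a => (M.gr a).comap M.mod.fixed.subtype.toAddMonoidHom }
  map f :=
    { hom := (GSModule.invariants G S).map f.hom
      map_gr := fun a m hm => f.map_gr a m.1 hm }
  map_id _ := rfl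
  map_comp _ _ := rfl

/-- The dual `M*`, with `(M*)_a = {φ | φ(M_b) ⊆ S_{a + b} for all b}`. -/
def dual [AddMonoid Γ] (𝓢 : Γ → AddSubgroup S) (M : FamGSModule G S Γ) : FamGSModule G S Γ where
  mod := M.mod.dual
  gr a :=
    { carrier := {φ : Module.Dual S M.mod | ∀ b, ∀ m ∈ M.gr b, φ m ∈ 𝓢 (a + b)}
      add_mem' := fun hφ hψ b m hm => add_mem (hφ b m hm) (hψ b m hm)
      zero_mem' := fun b _ _ => zero_mem (𝓢 (a + b))
      neg_mem' := fun hφ b m hm => neg_mem (hφ b m hm) }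

/-- The transpose `N* → M*` of a morphism `M → N`. -/
def dualMap [AddMonoid Γ] (𝓢 : Γ → AddSubgroup S) {M N : FamGSModule G S Γ} (f : M ⟶ N) :
    N.dual 𝓢 ⟶ M.dual 𝓢 where
  hom := GSModule.dualMap (Hom.hom f)
  map_gr _ _ hφ b m hm := hφ b _ (Hom.map_gr f b m hm)

/-- The functor `M ↦ M**`. -/
def doubleDual [AddMonoid Γ] (𝓢 : Γ → AddSubgroup S) : FamGSModule G S Γ ⥤ FamGSModule G S Γ where
  obj M := (M.dual 𝓢).dual 𝓢
  map f := dualMap 𝓢 (dualMap 𝓢 f)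
  map_id _ := rfl
  map_comp _ _ := rfl

/-- The `(G, S)`-module `S ⊗_R N`, whose component of degree `a` is generated, as an additive group,
by the `s ⊗ n` with `s ∈ S_c`, `n ∈ N_b` and `c + b = a`. -/
def baseChange [AddMonoid Γ] (𝓢 : Γ → AddSubgroup S)
    (N : FamModule (FixedPoints.subring S G) Γ) : FamGSModule G S Γ where
  mod := GSModule.baseChange N.mod
  gr a := AddSubgroup.closure {x : GSModule.baseChange N.mod |
    ∃ c b, c + b = a ∧ ∃ s ∈ 𝓢 c, ∃ n ∈ N.gr b, x = (s ⊗ₜ n : S ⊗[FixedPoints.subring S G] N.mod)}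

/-- The map `S ⊗_R N → S ⊗_R N'` induced by `N → N'`. -/
def baseChangeMap [AddMonoid Γ] (𝓢 : Γ → AddSubgroup S)
    {N N' : FamModule (FixedPoints.subring S G) Γ} (f : N ⟶ N') :
    baseChange 𝓢 N ⟶ baseChange 𝓢 N' where
  hom := GSModule.baseChangeMap (FamModule.Hom.hom f)
  map_gr a x hx := by
    have h : (baseChange 𝓢 N).gr a ≤ ((baseChange 𝓢 N').gr a).comap
        (GSModule.Hom.toLin (GSModule.baseChangeMap (FamModule.Hom.hom f))).toAddMonoidHom := by
      refine (AddSubgroup.closure_le _).2 ?_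
      rintro _ ⟨c, b, hcb, s, hs, n, hn, rfl⟩
      exact AddSubgroup.subset_closure
        ⟨c, b, hcb, s, hs, _, FamModule.Hom.map_gr f b n hn, LinearMap.baseChange_tmul _ _ _⟩
    exact h hx

/-- The functor `N ↦ S ⊗_R N`. -/
def extension [AddMonoid Γ] (𝓢 : Γ → AddSubgroup S) :
    FamModule (FixedPoints.subring S G) Γ ⥤ FamGSModule G S Γ where
  obj N := baseChange 𝓢 N
  map f := baseChangeMap 𝓢 f
  map_id N := FamGSModule.Hom.ext ((GSModule.extension G S).map_id N.mod)
  map_comp f f' := FamGSModule.Hom.ext ((GSModule.extension G S).map_comp f.hom f'.hom)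

end FamGSModule

/-! ### Equivalences between full subcategories -/

/-- `F : C ⥤ D` and `H : D ⥤ C` restrict to functors between the full subcategories on `P` and on
`Q`, and these restrictions are equivalences of categories that are quasi-inverse to each other. -/
def RestrictToQuasiInverse {C D : Type*} [Category C] [Category D]
    (P : ObjectProperty C) (Q : ObjectProperty D) (F : C ⥤ D) (H : D ⥤ C) : Prop :=
  ∃ (hF : ∀ X : P.FullSubcategory, Q (F.obj X.obj))
    (hH : ∀ Y : Q.FullSubcategory, P (H.obj Y.obj))
    (e : P.FullSubcategory ≌ Q.FullSubcategory),
    e.functor = Q.lift (P.ι ⋙ F) hF ∧ e.inverse = P.lift (Q.ι ⋙ H) hH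

end

noncomputable section

/-! ### Module-theoretic preliminaries -/

/-- A set `A` detects divisibility if `y ∣ a x` for all `a ∈ A` implies `y ∣ x`. (For a noetherian
normal domain: the ideal generated by `A` has height at least two.) -/
def DetectsDvd {S : Type*} [CommRing S] (A : Set S) : Prop :=
  ∀ x y : S, (∀ a ∈ A, y ∣ a * x) → y ∣ x

lemma DetectsDvd.exists_ne_zero {S : Type*} [CommRing S] [Nontrivial S] {A : Set S}
    (hA : DetectsDvd A) : ∃ a ∈ A, a ≠ 0 := by
  by_contra! h
  exact one_ne_zero (zero_dvd_iff.1 (hA 1 0 fun a ha => by simp [h a ha]))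

/-- Let `A` be a set which detects divisibility. If every element of `A` annihilates the kernel and
the cokernel of `φ : P → M`, then the transpose `M* → P*` is bijective. -/
lemma bijective_dualMap_of_detectsDvd {S : Type*} [CommRing S] [IsDomain S] {P M : Type*}
    [AddCommGroup P] [Module S P] [AddCommGroup M] [Module S M] (φ : P →ₗ[S] M) {A : Set S}
    (hA : DetectsDvd A) (hcoker : ∀ a ∈ A, ∀ m, ∃ y, φ y = a • m)
    (hker : ∀ a ∈ A, ∀ y, φ y = 0 → a • y = 0) : Function.Bijective φ.dualMap := by
  obtain ⟨a, ha, ha0⟩ := hA.exists_ne_zero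
  constructor
  · rw [injective_iff_map_eq_zero]
    intro f hf
    ext m
    obtain ⟨y, hy⟩ := hcoker a ha m
    have h : f (φ y) = 0 := LinearMap.congr_fun hf y
    rw [hy, map_smul, smul_eq_mul] at h
    simpa [ha0] using h
  · intro h
    have h0 : ∀ y, φ y = 0 → h y = 0 := fun y hy => by
      have : a * h y = 0 := by rw [← smul_eq_mul, ← map_smul, hker a ha y hy, map_zero]
      simpa [ha0] using this
    have h1 : ∀ y y', φ y = φ y' → h y = h y' := fun y y' hy =>
      sub_eq_zero.1 (by rw [← map_sub]; exact h0 _ (by rw [map_sub, hy, sub_self]))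
    -- The form extending `h` has to take the value `h y / a` at `m` whenever `φ y = a m`.
    have key : ∀ m, ∃ c, ∀ y, φ y = a • m → h y = a * c := by
      intro m
      obtain ⟨y, hy⟩ := hcoker a ha m
      -- If `φ z = b m`, then `b y` and `a z` have the same image, so `b (h y) = a (h z)`. Thus `a`
      -- divides `b (h y)` for every `b ∈ A`.
      obtain ⟨c, hc⟩ : a ∣ h y := hA _ _ fun b hb => by
        obtain ⟨z, hz⟩ := hcoker b hb m
        refine ⟨h z, ?_⟩
        rw [← smul_eq_mul, ← smul_eq_mul, ← map_smul, ← map_smul]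
        exact h1 _ _ (by rw [map_smul, map_smul, hy, hz, smul_comm])
      exact ⟨c, fun y' hy' => by rw [← hc]; exact h1 _ _ (hy'.trans hy.symm)⟩
    choose f hf using key
    have huniq : ∀ m c y, φ y = a • m → h y = a * c → f m = c := fun m c y hy hc =>
      mul_left_cancel₀ ha0 ((hf m y hy).symm.trans hc)
    refine ⟨⟨⟨f, fun m m' => ?_⟩, fun s m => ?_⟩, ?_⟩
    · obtain ⟨y, hy⟩ := hcoker a ha m
      obtain ⟨y', hy'⟩ := hcoker a ha m'
      refine huniq _ _ (y + y') (by rw [map_add, hy, hy', smul_add]) ?_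
      rw [map_add, hf m y hy, hf m' y' hy', mul_add]
    · obtain ⟨y, hy⟩ := hcoker a ha m
      refine huniq _ _ (s • y) (by rw [map_smul, hy, smul_comm]) ?_
      rw [map_smul, hf m y hy, smul_eq_mul, RingHom.id_apply, smul_eq_mul, mul_left_comm]
    · ext y
      exact huniq _ _ (a • y) (map_smul φ a y) (by rw [map_smul, smul_eq_mul])

/-- Over a domain, a finitely generated module contains elements `e i`, and has linear forms `w i`,
such that `∑ w i ⊗ e i` is a nonzero multiple of the identity on its dual. -/
lemma exists_dual_system (S : Type*) [CommRing S] [IsDomain S] (P : Type*) [AddCommGroup P]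
    [Module S P] [Module.Finite S P] :
    ∃ (d : S) (ι : Type) (_ : Fintype ι) (e : ι → P) (w : ι → Module.Dual S P), d ≠ 0 ∧
      ∀ x, d • x = ∑ i, w i x • e i := by
  classical
  obtain ⟨n, x, hx⟩ := Module.Finite.exists_fin (R := S) (M := P)
  -- By maximality each generator has a nonzero multiple in the free span of `s`. The product `d` of
  -- the multipliers carries the whole module into that span, and the `w i` are the coordinates of
  -- `d y` there.
  obtain ⟨s, hs, hmax⟩ := exists_maximal_linearIndepOn S x
  have h1 : ∀ i, ∃ a : S, a ≠ 0 ∧ a • x i ∈ Submodule.span S (x '' s) := fun i => by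
    by_cases hi : i ∈ s
    · exact ⟨1, one_ne_zero, by
        rw [one_smul]; exact Submodule.subset_span (Set.mem_image_of_mem x hi)⟩
    · exact hmax i hi
  choose a ha0 ha using h1
  set d := ∏ i, a i with hd
  have hd0 : d ≠ 0 := Finset.prod_ne_zero_iff.2 fun i _ => ha0 i
  have hmem : ∀ y : P, d • y ∈ Submodule.span S (Set.range fun i : s => x i) := by
    intro y
    have hy : y ∈ Submodule.span S (Set.range x) := hx ▸ Submodule.mem_top
    rw [show (Set.range fun i : s => x i) = x '' s by ext; simp]
    induction hy using Submodule.span_induction with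
    | mem y hy =>
      obtain ⟨i, rfl⟩ := hy
      rw [hd, ← Finset.prod_erase_mul _ _ (Finset.mem_univ i), mul_smul]
      exact Submodule.smul_mem _ _ (ha i)
    | zero => simp
    | add y z _ _ hy hz => rw [smul_add]; exact add_mem hy hz
    | smul r y _ hy => rw [smul_comm]; exact Submodule.smul_mem _ _ hy
  let b := Module.Basis.span (R := S) (v := fun i : s => x i) hs
  let D : P →ₗ[S] Submodule.span S (Set.range fun i : s => x i) :=
    (LinearMap.lsmul S P d).codRestrict _ hmem
  refine ⟨d, s, inferInstance, fun i => x i, fun i => b.coord i ∘ₗ D, hd0, fun y => ?_⟩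
  have := congrArg Subtype.val (b.sum_repr (D y))
  simp only [AddSubmonoidClass.coe_finsetSum, Submodule.coe_smul] at this
  rw [show d • y = (D y : P) from rfl, ← this]
  refine Finset.sum_congr rfl fun i _ => ?_
  rw [show (b i : P) = x i from congrArg Subtype.val (Module.Basis.span_apply hs i) |>.trans rfl]
  rfl

/-- Over a domain, the dual of a finitely generated module is reflexive. -/
lemma isReflexive_dual_of_finite (S : Type*) [CommRing S] [IsDomain S] (P : Type*)
    [AddCommGroup P] [Module S P] [Module.Finite S P] :
    Module.IsReflexive S (Module.Dual S P) := by
  -- Evaluation on the dual has a left inverse, so bijectivity reduces to the injectivity of that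
  -- left inverse.
  have hleft : Function.LeftInverse (Module.Dual.eval S P).dualMap
      (Module.Dual.eval S (Module.Dual S P)) := fun f => rfl
  have hinj : Function.Injective (Module.Dual.eval S P).dualMap := by
    rw [injective_iff_map_eq_zero]
    intro χ hχ
    obtain ⟨d, ι, _, e, w, hd, hw⟩ := exists_dual_system S P
    ext ψ
    -- Up to the factor `d`, every element of the bidual is evaluation at an element of `P`, where
    -- `χ` vanishes.
    have h1 : d • ψ = Module.Dual.eval S P (∑ i, ψ (w i) • e i) := by
      ext f
      have h2 : d • f = ∑ i, f (e i) • w i := by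
        ext x
        rw [LinearMap.smul_apply, ← map_smul, hw, map_sum]
        simp [mul_comm]
      rw [LinearMap.smul_apply, ← map_smul, h2]
      simp [mul_comm]
    have h3 : χ (d • ψ) = 0 := by
      rw [h1]; exact LinearMap.congr_fun hχ _
    rw [map_smul, smul_eq_mul] at h3
    simpa [hd] using h3
  exact ⟨hleft.injective, fun χ => ⟨_, hinj (hleft _)⟩⟩

/-! ### Invariants, extension of scalars and duality for `(G, S)`-modules -/

/-- The elements `a` of `S` such that `S ⊗ S` contains an element `∑ s ⊗ t` with
`∑ s (g t) = a` for `g = 1`, and `∑ s (g t) = 0` for `g ≠ 1`. -/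
def galoisElements (G S : Type*) [Group G] [CommRing S] [MulSemiringAction G S] : Set S :=
  {a | ∃ F : Finset (S × S), (∑ i ∈ F, i.1 * i.2 = a) ∧
    ∀ g : G, g ≠ 1 → ∑ i ∈ F, i.1 * g • i.2 = 0}

namespace GSModule

variable {G : Type v} {S : Type u} [Group G] [CommRing S] [MulSemiringAction G S]

/-- The trace `m ↦ ∑ g m`. -/
def trace [Fintype G] (M : GSModule G S) : M →ₗ[FixedPoints.subring S G] M.fixed where
  toFun m := ⟨∑ g : G, g • m, fun h => by
    rw [Finset.smul_sum]
    simp_rw [← mul_smul]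
    exact Fintype.sum_equiv (Equiv.mulLeft h) _ _ fun g => rfl⟩
  map_add' a b := Subtype.ext (by simp [Finset.sum_add_distrib])
  map_smul' r m := Subtype.ext (by
    change ∑ g : G, g • ((r : S) • m) = (r : S) • ∑ g : G, g • m
    rw [Finset.smul_sum]
    refine Finset.sum_congr rfl fun g _ => ?_
    rw [M.smul_smul', show g • (r : S) = r from r.2 g])

lemma coe_trace [Fintype G] (M : GSModule G S) (m : M) : (M.trace m : M) = ∑ g : G, g • m := rfl

lemma trace_smul_fixed [Fintype G] (M : GSModule G S) (s : S) (m : M.fixed) :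
    ∃ r : FixedPoints.subring S G, (r : S) = ∑ g : G, g • s ∧ M.trace (s • (m : M)) = r • m := by
  refine ⟨⟨∑ g : G, g • s, fun h => ?_⟩, rfl, Subtype.ext ?_⟩
  · rw [Finset.smul_sum]
    simp_rw [← mul_smul]
    exact Fintype.sum_equiv (Equiv.mulLeft h) _ _ fun g => rfl
  · change ∑ g : G, g • (s • (m : M)) = (∑ g : G, g • s) • (m : M)
    rw [Finset.sum_smul]
    refine Finset.sum_congr rfl fun g _ => ?_
    rw [M.smul_smul', m.2 g]

/-- After the sums are exchanged, the coefficient of `g m` is `∑ s (g t)`, which is `a` for `g = 1`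
and zero otherwise. -/
lemma galois_expansion [Fintype G] (M : GSModule G S) {a : S} {F : Finset (S × S)}
    (h1 : ∑ i ∈ F, i.1 * i.2 = a) (h2 : ∀ g : G, g ≠ 1 → ∑ i ∈ F, i.1 * g • i.2 = 0) (m : M) :
    ∑ i ∈ F, i.1 • (M.trace (i.2 • m) : M) = a • m := by
  classical
  simp_rw [coe_trace, M.smul_smul', Finset.smul_sum, smul_smul]
  rw [Finset.sum_comm, Finset.sum_eq_single (1 : G)]
  · simp_rw [one_smul, ← Finset.sum_smul, h1]
  · intro g _ hg
    rw [← Finset.sum_smul, h2 g hg, zero_smul]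
  · simp

/-- The canonical map `S ⊗_R M^G → M`, `s ⊗ m ↦ s m`. -/
def actionMap (M : GSModule G S) : (extension G S).obj ((invariants G S).obj M) ⟶ M where
  toLin := LinearMap.liftBaseChange S M.fixed.subtype
  map_act g x := by
    change S ⊗[FixedPoints.subring S G] M.fixed at x
    change LinearMap.liftBaseChange S M.fixed.subtype (g • x) =
      g • LinearMap.liftBaseChange S M.fixed.subtype x
    induction x using TensorProduct.induction_on with
    | zero => simp
    | tmul s m =>
      rw [TensorProduct.smul_tmul', LinearMap.liftBaseChange_tmul, LinearMap.liftBaseChange_tmul,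
        M.smul_smul']
      exact congrArg _ (m.2 g).symm
    | add a b ha hb => simp only [smul_add, map_add, ha, hb]

lemma actionMap_tmul (M : GSModule G S) (s : S) (m : M.fixed) :
    Hom.toLin M.actionMap (s ⊗ₜ[FixedPoints.subring S G] m :
      S ⊗[FixedPoints.subring S G] M.fixed) = s • (m : M) :=
  LinearMap.liftBaseChange_tmul ..

variable (G S) in
/-- The maps `S ⊗_R M^G → M` are natural. -/
def actionNatTrans : invariants G S ⋙ extension G S ⟶ 𝟭 (GSModule G S) where
  app M := M.actionMap
  naturality M N f := by
    apply hom_ext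
    refine LinearMap.ext fun x => ?_
    change S ⊗[FixedPoints.subring S G] M.fixed at x
    change LinearMap.liftBaseChange S N.fixed.subtype (LinearMap.baseChange S (fixedMap f) x) =
      Hom.toLin f (LinearMap.liftBaseChange S M.fixed.subtype x)
    induction x using TensorProduct.induction_on with
    | zero => simp
    | tmul s m =>
      rw [LinearMap.baseChange_tmul, LinearMap.liftBaseChange_tmul,
        LinearMap.liftBaseChange_tmul, map_smul]
      rfl
    | add a b ha hb => simp only [map_add, ha, hb]

/-- The Galois expansion writes `a m` as an `S`-combination of traces, which are invariant. -/
lemma exists_actionMap_eq [Finite G] (M : GSModule G S) {a : S} (ha : a ∈ galoisElements G S)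
    (m : M) : ∃ y, Hom.toLin M.actionMap y = a • m := by
  cases nonempty_fintype G
  obtain ⟨F, h1, h2⟩ := ha
  refine ⟨(∑ i ∈ F, i.1 ⊗ₜ[FixedPoints.subring S G] M.trace (i.2 • m) :
    S ⊗[FixedPoints.subring S G] M.fixed), ?_⟩
  rw [← M.galois_expansion h1 h2]
  refine (map_sum (LinearMap.liftBaseChange S M.fixed.subtype) _ F).trans ?_
  exact Finset.sum_congr rfl fun i _ => M.actionMap_tmul _ _

/-- Multiplication by `a` on `S ⊗_R M^G` factors through the action map, by way of `m ↦ ∑ s ⊗ trace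
(t m)`. -/
lemma smul_eq_zero_of_actionMap [Finite G] (M : GSModule G S) {a : S}
    (ha : a ∈ galoisElements G S) (y : S ⊗[FixedPoints.subring S G] M.fixed)
    (hy : Hom.toLin M.actionMap y = 0) : a • y = 0 := by
  cases nonempty_fintype G
  obtain ⟨F, h1, h2⟩ := ha
  have key : ∀ y : S ⊗[FixedPoints.subring S G] M.fixed, a • y =
      ∑ i ∈ F, i.1 ⊗ₜ M.trace (i.2 • (LinearMap.liftBaseChange S M.fixed.subtype y)) := by
    intro y
    induction y using TensorProduct.induction_on with
    | zero => simp
    | tmul s m =>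
      -- The expansion is applied to `S` itself. The traces that occur lie in `R` and can be moved
      -- across the tensor sign.
      let SS : GSModule G S := ⟨S, fun g s m => smul_mul' g s m⟩
      have h3 : ∑ i ∈ F, i.1 * ∑ g : G, g • (i.2 * s) = a * s :=
        galois_expansion SS h1 h2 s
      rw [TensorProduct.smul_tmul', smul_eq_mul, ← h3, TensorProduct.sum_tmul]
      refine Finset.sum_congr rfl fun i _ => ?_
      rw [LinearMap.liftBaseChange_tmul, smul_smul]
      obtain ⟨r, hr, hr'⟩ := M.trace_smul_fixed (i.2 * s) m
      rw [Submodule.subtype_apply, hr', ← TensorProduct.smul_tmul, ← hr]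
      congr 1
      exact mul_comm _ _
    | add x y hx hy => simp only [smul_add, map_add, TensorProduct.tmul_add,
        Finset.sum_add_distrib, hx, hy]
  rw [key y, show LinearMap.liftBaseChange S M.fixed.subtype y = 0 from hy]
  simp

lemma bijective_dualMap_actionMap [IsDomain S] [Finite G]
    (hA : DetectsDvd (galoisElements G S)) (M : GSModule G S) :
    Function.Bijective (Hom.toLin M.actionMap).dualMap :=
  bijective_dualMap_of_detectsDvd _ hA (fun _ ha m => M.exists_actionMap_eq ha m)
    (fun _ ha y hy => M.smul_eq_zero_of_actionMap ha y hy)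

/-- An invariant linear form on `M` restricts to an `R`-linear form on `M^G`, where `R = S^G`. -/
def restrictDual (M : GSModule G S) :
    M.dual.fixed →ₗ[FixedPoints.subring S G] Module.Dual (FixedPoints.subring S G) M.fixed where
  toFun f :=
    { toFun := fun m => ⟨(show Module.Dual S M from f.1) m, fun g => by
        have h : g • (show Module.Dual S M from f.1) (g⁻¹ • (m : M)) =
          (show Module.Dual S M from f.1) m :=
            LinearMap.congr_fun (show (_ : Module.Dual S M) = _ from f.2 g) (m : M)
        rwa [m.2 g⁻¹] at h⟩
      map_add' := fun a b => Subtype.ext (map_add (show Module.Dual S M from f.1) (a : M) b)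
      map_smul' := fun r a =>
        Subtype.ext (map_smul (show Module.Dual S M from f.1) (r : S) (a : M)) }
  map_add' _ _ := rfl
  map_smul' _ _ := rfl

lemma coe_restrictDual (M : GSModule G S) (f : M.dual.fixed) (m : M.fixed) :
    (M.restrictDual f m : S) = (show Module.Dual S M from f.1) m := rfl

/-- Both forms have the same pullback to `S ⊗_R M^G`, and the transpose of the action map is
injective. -/
lemma dual_ext_of_fixed [IsDomain S] [Finite G] (hA : DetectsDvd (galoisElements G S))
    (M : GSModule G S) {f f' : Module.Dual S M} (h : ∀ m : M.fixed, f m = f' m) : f = f' := by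
  refine (M.bijective_dualMap_actionMap hA).1 ?_
  refine LinearMap.ext fun x => ?_
  change S ⊗[FixedPoints.subring S G] M.fixed at x
  change f (LinearMap.liftBaseChange S M.fixed.subtype x) =
    f' (LinearMap.liftBaseChange S M.fixed.subtype x)
  induction x using TensorProduct.induction_on with
  | zero => simp
  | tmul s m => simp [h]
  | add a b ha hb => simp only [map_add, ha, hb]

/-- For surjectivity, a form on `M^G` is extended `S`-linearly to `S ⊗_R M^G` and then descends to
`M` because the transpose of the action map is surjective. The result is invariant because it is
determined by its values on `M^G`. -/
lemma bijective_restrictDual [IsDomain S] [Finite G] (hA : DetectsDvd (galoisElements G S))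
    (M : GSModule G S) : Function.Bijective M.restrictDual := by
  constructor
  · intro f f' h
    exact Subtype.ext (M.dual_ext_of_fixed hA fun m => by
      rw [← coe_restrictDual, h, coe_restrictDual])
  · intro h
    let h' : M.fixed →ₗ[FixedPoints.subring S G] S :=
      (Algebra.linearMap (FixedPoints.subring S G) S) ∘ₗ h
    obtain ⟨f, hf⟩ := (M.bijective_dualMap_actionMap hA).2 (LinearMap.liftBaseChange S h')
    have hf' : ∀ m : M.fixed, f m = h m := fun m => by
      have h1 : f (LinearMap.liftBaseChange S M.fixed.subtype
        ((1 : S) ⊗ₜ[FixedPoints.subring S G] m)) =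
          LinearMap.liftBaseChange S h' ((1 : S) ⊗ₜ[FixedPoints.subring S G] m) :=
        LinearMap.congr_fun hf _
      rw [LinearMap.liftBaseChange_tmul, LinearMap.liftBaseChange_tmul, one_smul, one_smul] at h1
      exact h1
    refine ⟨⟨f, fun g => ?_⟩, LinearMap.ext fun m => Subtype.ext (hf' m)⟩
    refine M.dual_ext_of_fixed hA fun m => ?_
    rw [dual_smul_apply, m.2 g⁻¹, hf']
    exact (h m).2 g

/-- The canonical map `M → M**`. -/
def evalMap (M : GSModule G S) : M ⟶ M.dual.dual where
  toLin := Module.Dual.eval S M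
  map_act g m := LinearMap.ext fun f => by
    change (show Module.Dual S M from f) (g • m) =
      g • g⁻¹ • (show Module.Dual S M from f) ((g⁻¹)⁻¹ • m)
    rw [smul_inv_smul, inv_inv]

variable (G S) in
/-- The maps `M → M**` are natural. -/
def evalNatTrans : 𝟭 (GSModule G S) ⟶ doubleDual G S where
  app M := M.evalMap
  naturality _ _ _ := rfl

/-- The canonical map `N → (S ⊗_R N)^G`, `n ↦ 1 ⊗ n`. -/
def oneTMul (N : ModuleCat.{u} (FixedPoints.subring S G)) :
    N →ₗ[FixedPoints.subring S G] (baseChange N).fixed where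
  toFun n := ⟨((1 : S) ⊗ₜ n : S ⊗[FixedPoints.subring S G] N), fun g => by
    change g • ((1 : S) ⊗ₜ n : S ⊗[FixedPoints.subring S G] N) = _
    rw [TensorProduct.smul_tmul', smul_one]⟩
  map_add' a b := Subtype.ext (TensorProduct.tmul_add _ _ _)
  map_smul' r a := Subtype.ext (TensorProduct.tmul_smul r (1 : S) a)

/-- The canonical map `N → ((S ⊗_R N)**)^G`. -/
def toInvariants (N : ModuleCat.{u} (FixedPoints.subring S G)) :
    N →ₗ[FixedPoints.subring S G] (baseChange N).dual.dual.fixed :=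
  fixedMap (baseChange N).evalMap ∘ₗ oneTMul N

variable (G S) in
/-- The maps `N → ((S ⊗_R N)**)^G` are natural. -/
def toInvariantsNatTrans : 𝟭 (ModuleCat.{u} (FixedPoints.subring S G)) ⟶
    (extension G S ⋙ doubleDual G S) ⋙ invariants G S where
  app N := ModuleCat.ofHom (toInvariants N)
  naturality N N' f := by
    ext n
    refine Subtype.ext (LinearMap.ext fun (g : Module.Dual S _) => ?_)
    exact congrArg g (LinearMap.baseChange_tmul (A := S) (f := f.hom) (1 : S) n).symm

/-- For an `R`-module `N`, restriction to `N` identifies the invariant linear forms on `S ⊗_R N`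
with the `R`-linear forms on `N`. -/
lemma bijective_invariant_dual_baseChange (N : ModuleCat.{u} (FixedPoints.subring S G)) :
    Function.Bijective ((oneTMul N).dualMap ∘ₗ (baseChange N).restrictDual) := by
  constructor
  · intro f f' h
    have key : ∀ f f' : S ⊗[FixedPoints.subring S G] N →ₗ[S] S,
        (∀ n, f (1 ⊗ₜ n) = f' (1 ⊗ₜ n)) → f = f' := fun f f' h => by
      ext n
      exact h n
    exact Subtype.ext (key _ _ fun n => congrArg Subtype.val (LinearMap.congr_fun h n))
  · intro f
    let f' : N →ₗ[FixedPoints.subring S G] S :=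
      (Algebra.linearMap (FixedPoints.subring S G) S) ∘ₗ f
    refine ⟨⟨LinearMap.liftBaseChange S f', fun g => ?_⟩, LinearMap.ext fun n => Subtype.ext ?_⟩
    · refine LinearMap.ext fun x => ?_
      change S ⊗[FixedPoints.subring S G] N at x
      change g • LinearMap.liftBaseChange S f' (g⁻¹ • x) = LinearMap.liftBaseChange S f' x
      induction x using TensorProduct.induction_on with
      | zero => simp
      | tmul s n =>
        rw [TensorProduct.smul_tmul', LinearMap.liftBaseChange_tmul,
          LinearMap.liftBaseChange_tmul, smul_eq_mul, smul_mul', smul_inv_smul]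
        exact congrArg _ ((f n).2 g)
      | add a b ha hb => simp only [smul_add, map_add, ha, hb]
    · change LinearMap.liftBaseChange S f' (1 ⊗ₜ n) = f n
      rw [LinearMap.liftBaseChange_tmul, one_smul]
      rfl

/-- With `T = (S ⊗_R N)*`, the identifications `(T*)^G ≅ (T^G)*` and `T^G ≅ N*` turn this map into
the canonical map `N → N**`. -/
lemma bijective_toInvariants [IsDomain S] [Finite G] (hA : DetectsDvd (galoisElements G S))
    (N : ModuleCat.{u} (FixedPoints.subring S G))
    (hN : Module.IsReflexive (FixedPoints.subring S G) N) :
    Function.Bijective (toInvariants N) := by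
  have hβ := bijective_invariant_dual_baseChange N
  let T := (baseChange N).dual
  let β := LinearEquiv.ofBijective _ hβ
  have hcomp : ∀ (n : N) (f : T.fixed), T.restrictDual (toInvariants N n) f = β f n :=
    fun n f => rfl
  constructor
  · rw [injective_iff_map_eq_zero]
    intro n hn
    refine hN.bijective_dual_eval'.1 (LinearMap.ext fun f => ?_)
    obtain ⟨f, rfl⟩ := hβ.2 f
    refine (hcomp n f).symm.trans ?_
    rw [hn, map_zero, map_zero]
    rfl
  · intro ψ
    obtain ⟨n, hn⟩ := hN.bijective_dual_eval'.2 (T.restrictDual ψ ∘ₗ β.symm.toLinearMap)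
    refine ⟨n, (T.bijective_restrictDual hA).1 (LinearMap.ext fun f => ?_)⟩
    refine ((hcomp n f).trans (LinearMap.congr_fun hn (β f))).trans ?_
    exact congrArg (T.restrictDual ψ) (β.symm_apply_apply f)

/-! ### Preservation of reflexivity and finiteness -/

lemma isReflexive_fixed [IsDomain S] [Finite G] (hA : DetectsDvd (galoisElements G S))
    (M : GSModule G S) (hM : Module.IsReflexive S M) :
    Module.IsReflexive (FixedPoints.subring S G) M.fixed := by
  constructor
  constructor
  · rw [injective_iff_map_eq_zero]
    intro m hm
    have h : Module.Dual.eval S M m = 0 := M.dual.dual_ext_of_fixed hA fun f =>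
      congrArg Subtype.val (LinearMap.congr_fun hm (M.restrictDual f))
    exact Subtype.ext ((injective_iff_map_eq_zero _).1 hM.bijective_dual_eval'.1 _ h)
  · intro χ
    -- An element of `(M^G)**` comes from an invariant element of `M**`. This is evaluation at some
    -- `m`, which is invariant because evaluation is injective and equivariant.
    obtain ⟨ψ, hψ⟩ := (M.dual.bijective_restrictDual hA).2 (χ ∘ₗ M.restrictDual)
    obtain ⟨m, hm⟩ := hM.bijective_dual_eval'.2 ψ.1
    refine ⟨⟨m, fun g => hM.bijective_dual_eval'.1 ?_⟩, LinearMap.ext fun f => ?_⟩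
    · refine (M.evalMap.map_act g m).trans ?_
      change g • (show M.dual.dual from Module.Dual.eval S M m) = _
      rw [hm]
      exact ψ.2 g
    · obtain ⟨f, rfl⟩ := (M.bijective_restrictDual hA).2 f
      refine Eq.trans ?_ (LinearMap.congr_fun hψ f)
      exact Subtype.ext (LinearMap.congr_fun hm f.1)

/-- `M` is finite over `R` because `S` is, and the trace maps it onto `M^G` because the order of `G`
is invertible. -/
lemma finite_fixed [Finite G] [Module.Finite (FixedPoints.subring S G) S]
    (hG : IsUnit (Nat.card G : S)) (M : GSModule G S) (hM : Module.Finite S M) :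
    Module.Finite (FixedPoints.subring S G) M.fixed := by
  cases nonempty_fintype G
  have : Module.Finite (FixedPoints.subring S G) M := Module.Finite.trans S M
  refine Module.Finite.of_surjective M.trace fun m => ?_
  obtain ⟨e, he⟩ := hG.exists_right_inv
  refine ⟨e • (m : M), ?_⟩
  obtain ⟨r, hr, h⟩ := M.trace_smul_fixed e m
  -- The inverse `e` of the group order is invariant, so the trace of `e m` is `|G| e m = m`.
  have hge : ∀ g : G, g • e = e := fun g => by
    have h1 : (Nat.card G : S) * (g • e) = 1 := by
      have h2 := congrArg (g • ·) he
      simp only [smul_mul', smul_one] at h2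
      rwa [show g • (Nat.card G : S) = Nat.card G from
        map_natCast (MulSemiringAction.toRingHom G S g) _] at h2
    exact hG.mul_left_cancel (h1.trans he.symm)
  have hr1 : r = 1 := Subtype.ext (by
    simp_rw [hr, hge]
    simpa [Nat.card_eq_fintype_card] using he)
  rw [h, hr1, one_smul]

lemma reflexive_doubleDual [IsDomain S] [IsNoetherianRing S] (M : GSModule G S)
    (hM : Module.Finite S M) : reflexive G S M.dual.dual := by
  have h1 : Module.Finite S (Module.Dual S M) := inferInstance
  have h2 : Module.Finite S (Module.Dual S (Module.Dual S M)) := inferInstance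
  exact ⟨h2, isReflexive_dual_of_finite S (Module.Dual S M)⟩

lemma finite_baseChange (N : ModuleCat.{u} (FixedPoints.subring S G))
    (hN : Module.Finite (FixedPoints.subring S G) N) : Module.Finite S (baseChange N) :=
  Module.Finite.base_change (FixedPoints.subring S G) S N

/-- A bijective morphism of `(G, S)`-modules is an isomorphism. -/
def isoOfBijective {M N : GSModule G S} (f : M ⟶ N) (hf : Function.Bijective (Hom.toLin f)) :
    M ≅ N where
  hom := f
  inv :=
    { toLin := (LinearEquiv.ofBijective (Hom.toLin f) hf).symm.toLinearMap
      map_act := fun g m => hf.1 (by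
        have h := (LinearEquiv.ofBijective (Hom.toLin f) hf).apply_symm_apply
        rw [Hom.map_act]
        exact (h (g • m)).trans (congrArg (g • ·) (h m).symm)) }
  hom_inv_id := hom_ext (LinearMap.ext (LinearEquiv.ofBijective (Hom.toLin f) hf).symm_apply_apply)
  inv_hom_id := hom_ext (LinearMap.ext (LinearEquiv.ofBijective (Hom.toLin f) hf).apply_symm_apply)

end GSModule

/-- Functors `F` and `H` that preserve `P` and `Q` restrict to quasi-inverse equivalences if, on the
full subcategories, `𝟭` and `H F` are naturally isomorphic to a third functor `K`, and `𝟭` to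
`F H`. -/
lemma RestrictToQuasiInverse.of_natTrans {C D : Type*} [Category C] [Category D]
    {P : ObjectProperty C} {Q : ObjectProperty D} {F : C ⥤ D} {H : D ⥤ C} {K : C ⥤ C}
    (hF : ∀ X, P X → Q (F.obj X)) (hH : ∀ Y, Q Y → P (H.obj Y))
    (α : P.ι ⋙ 𝟭 C ⟶ P.ι ⋙ K) (hα : ∀ X, IsIso (α.app X))
    (β : P.ι ⋙ F ⋙ H ⟶ P.ι ⋙ K) (hβ : ∀ X, IsIso (β.app X))
    (γ : Q.ι ⋙ 𝟭 D ⟶ Q.ι ⋙ H ⋙ F) (hγ : ∀ Y, IsIso (γ.app Y)) :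
    RestrictToQuasiInverse P Q F H := by
  let F' : P.FullSubcategory ⥤ Q.FullSubcategory := Q.lift (P.ι ⋙ F) fun X => hF _ X.property
  let H' : Q.FullSubcategory ⥤ P.FullSubcategory := P.lift (Q.ι ⋙ H) fun Y => hH _ Y.property
  let η' : P.ι ⋙ 𝟭 C ≅ P.ι ⋙ F ⋙ H :=
    NatIso.ofComponents (fun X => asIso (α.app X)) (fun f => α.naturality f) ≪≫
    (NatIso.ofComponents (fun X => asIso (β.app X)) fun f => β.naturality f).symm
  let η : 𝟭 P.FullSubcategory ≅ F' ⋙ H' := NatIso.ofComponents (fun X => P.isoMk (η'.app X))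
    (fun {X Y} f => ObjectProperty.hom_ext _ (η'.hom.naturality f))
  let ε : 𝟭 Q.FullSubcategory ≅ H' ⋙ F' := NatIso.ofComponents
    (fun Y => Q.isoMk (asIso (γ.app Y)))
    (fun {X Y} f => ObjectProperty.hom_ext _ (γ.naturality f))
  -- `Equivalence.mk` adjusts only the unit to obtain the triangle identity. The two functors are
  -- unchanged, so both equalities hold by `rfl`.
  exact ⟨fun X => hF _ X.property, fun Y => hH _ Y.property,
    CategoryTheory.Equivalence.mk F' H' η ε.symm, rfl, rfl⟩

/-! ### The ungraded equivalence -/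

namespace GSModule

variable {G : Type v} {S : Type u} [Group G] [CommRing S] [MulSemiringAction G S]

lemma bijective_doubleDual_actionMap [IsDomain S] [Finite G]
    (hA : DetectsDvd (galoisElements G S)) (M : GSModule G S) :
    Function.Bijective (Hom.toLin ((doubleDual G S).map M.actionMap)) := by
  let e := LinearEquiv.ofBijective _ (M.bijective_dualMap_actionMap hA)
  exact e.dualMap.bijective

/-- `M` and `(S ⊗_R M^G)**` are compared through `M**`, to which both map naturally. -/
theorem restrictToQuasiInverse [IsDomain S] [IsNoetherianRing S] [Finite G]
    [Module.Finite (FixedPoints.subring S G) S] (hG : IsUnit (Nat.card G : S))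
    (hA : DetectsDvd (galoisElements G S)) :
    RestrictToQuasiInverse (reflexive G S) (reflexiveModules (FixedPoints.subring S G))
      (invariants G S) (extension G S ⋙ doubleDual G S) := by
  refine RestrictToQuasiInverse.of_natTrans (K := doubleDual G S)
    (fun M hM => ⟨M.finite_fixed hG hM.1, M.isReflexive_fixed hA hM.2⟩)
    (fun N hN => (baseChange N).reflexive_doubleDual (finite_baseChange N hN.1))
    (Functor.whiskerLeft _ (evalNatTrans G S))
    (fun M => (isoOfBijective (evalMap _) M.2.2.bijective_dual_eval').isIso_hom)
    (Functor.whiskerLeft _ (Functor.whiskerRight (actionNatTrans G S) (doubleDual G S)))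
    (fun M => (isoOfBijective _ (bijective_doubleDual_actionMap hA _)).isIso_hom)
    (Functor.whiskerLeft _ (toInvariantsNatTrans G S)) (fun N => ?_)
  exact (LinearEquiv.ofBijective _ (bijective_toInvariants hA _ N.2.2)).toModuleIso.isIso_hom

end GSModule

/-! ### Internal gradings -/

namespace DirectSum.IsInternal

variable {Γ : Type*} [DecidableEq Γ] {M : Type*} [AddCommGroup M] {gr : Γ → AddSubgroup M}

lemma exists_lift (h : DirectSum.IsInternal gr) {P : Type*} [AddCommMonoid P]
    (f : ∀ b, gr b →+ P) : ∃ F : M →+ P, ∀ b x (hx : x ∈ gr b), F x = f b ⟨x, hx⟩ := by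
  let e := AddEquiv.ofBijective (DirectSum.coeAddMonoidHom gr) h
  refine ⟨(DirectSum.toAddMonoid f).comp e.symm.toAddMonoidHom, fun b x hx => ?_⟩
  have : e.symm x = DirectSum.of (fun a => gr a) b ⟨x, hx⟩ := by
    rw [AddEquiv.symm_apply_eq]
    exact (DirectSum.coeAddMonoidHom_of gr b ⟨x, hx⟩).symm
  change DirectSum.toAddMonoid f (e.symm x) = _
  rw [this, DirectSum.toAddMonoid_of]

@[elab_as_elim]
lemma induction (h : DirectSum.IsInternal gr) {motive : M → Prop} (x : M) (zero : motive 0)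
    (mem : ∀ a x, x ∈ gr a → motive x) (add : ∀ x y, motive x → motive y → motive (x + y)) :
    motive x := by
  obtain ⟨y, rfl⟩ := h.2 x
  induction y using DirectSum.induction_on with
  | zero => simpa using zero
  | of a x => simpa using mem a x x.2
  | add x y hx hy => rw [map_add]; exact add _ _ hx hy

lemma exists_proj (h : DirectSum.IsInternal gr) (a : Γ) : ∃ π : M →+ M,
    (∀ x ∈ gr a, π x = x) ∧ ∀ b, a ≠ b → ∀ x ∈ gr b, π x = 0 := by
  obtain ⟨π, hπ⟩ := h.exists_lift fun b => if a = b then (gr b).subtype else 0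
  exact ⟨π, fun x hx => by simp [hπ a x hx], fun b hab x hx => by simp [hπ b x hx, hab]⟩

/-- The projection to the component of degree `a`. -/
def proj (h : DirectSum.IsInternal gr) (a : Γ) : M →+ M := (h.exists_proj a).choose

lemma proj_of_mem (h : DirectSum.IsInternal gr) {a : Γ} {x : M} (hx : x ∈ gr a) :
    h.proj a x = x := (h.exists_proj a).choose_spec.1 x hx

lemma proj_of_mem_ne (h : DirectSum.IsInternal gr) {a b : Γ} (hab : a ≠ b) {x : M}
    (hx : x ∈ gr b) : h.proj a x = 0 := (h.exists_proj a).choose_spec.2 b hab x hx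

lemma proj_mem (h : DirectSum.IsInternal gr) (a : Γ) (x : M) : h.proj a x ∈ gr a := by
  induction x using h.induction with
  | zero => simp
  | mem b x hx =>
    by_cases hab : a = b
    · subst hab; rwa [h.proj_of_mem hx]
    · rw [h.proj_of_mem_ne hab hx]; exact zero_mem _
  | add x y hx hy => rw [map_add]; exact add_mem hx hy

/-- Allowing every larger index set makes the statement additive in `x`: a union of index sets works
for a sum. -/
lemma exists_sum_proj (h : DirectSum.IsInternal gr) (x : M) :
    ∃ F : Finset Γ, ∀ F', F ⊆ F' → ∑ a ∈ F', h.proj a x = x := by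
  induction x using h.induction with
  | zero => exact ⟨∅, fun F' _ => by simp⟩
  | mem b x hx =>
    refine ⟨{b}, fun F' hF' => ?_⟩
    rw [Finset.sum_eq_single b (fun a _ hab => h.proj_of_mem_ne hab hx)
      (fun hb => (hb (hF' (Finset.mem_singleton_self b))).elim), h.proj_of_mem hx]
  | add x y hx hy =>
    obtain ⟨F, hF⟩ := hx
    obtain ⟨F₁, hF₁⟩ := hy
    refine ⟨F ∪ F₁, fun F' hF' => ?_⟩
    simp_rw [map_add]
    rw [Finset.sum_add_distrib, hF F' (Finset.union_subset_left hF'),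
      hF₁ F' (Finset.union_subset_right hF')]

/-- The reindexing `e` covers multiplication by a homogeneous element, where it is a translation, as
well as degree-preserving maps, where it is the identity. -/
lemma proj_map (h : DirectSum.IsInternal gr) {N : Type*} [AddCommGroup N]
    {gr' : Γ → AddSubgroup N} (h' : DirectSum.IsInternal gr') (f : M →+ N) {e : Γ → Γ}
    (he : Function.Injective e) (hf : ∀ a, ∀ x ∈ gr a, f x ∈ gr' (e a)) (a : Γ) (x : M) :
    h'.proj (e a) (f x) = f (h.proj a x) := by
  induction x using h.induction with
  | zero => simp
  | mem b x hx =>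
    by_cases hab : a = b
    · subst hab; rw [h.proj_of_mem hx, h'.proj_of_mem (hf a x hx)]
    · rw [h.proj_of_mem_ne hab hx, h'.proj_of_mem_ne (he.ne hab) (hf b x hx), map_zero]
  | add x y hx hy => simp only [map_add, hx, hy]

/-- An injective degree-preserving map between graded groups reflects degrees. -/
lemma mem_of_map_mem (h : DirectSum.IsInternal gr) {N : Type*} [AddCommGroup N]
    {gr' : Γ → AddSubgroup N} (h' : DirectSum.IsInternal gr') (f : M →+ N)
    (hinj : Function.Injective f) (hf : ∀ a, ∀ x ∈ gr a, f x ∈ gr' a) {a : Γ} {x : M}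
    (hx : f x ∈ gr' a) : x ∈ gr a := by
  have h1 : h.proj a x = x := hinj (by
    rw [← h.proj_map h' f Function.injective_id hf, id, h'.proj_of_mem hx])
  exact h1 ▸ h.proj_mem a x

/-- A family of subgroups which generates `M` is a grading if there are maps on `M` that are
injective on one of them and vanish on the others. -/
lemma of_detect (hsup : ∀ x : M, x ∈ ⨆ a, gr a) {P : Type*} [AddCommGroup P]
    (π : Γ → M →+ P) (hne : ∀ a b, a ≠ b → ∀ x ∈ gr b, π a x = 0)
    (hinj : ∀ a, ∀ x ∈ gr a, π a x = 0 → x = 0) : DirectSum.IsInternal gr := by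
  constructor
  · rw [injective_iff_map_eq_zero]
    intro y hy
    refine DFinsupp.ext fun a => Subtype.ext (hinj a _ (y a).2 ?_)
    have : ∀ y : DirectSum Γ fun a => gr a,
        π a (y a) = π a (DirectSum.coeAddMonoidHom gr y) := fun y => by
      induction y using DirectSum.induction_on with
      | zero => simp
      | of b x =>
        rw [DirectSum.coeAddMonoidHom_of]
        by_cases hab : a = b
        · subst hab; rw [DirectSum.of_eq_same]
        · rw [DirectSum.of_eq_of_ne _ _ _ hab, hne a b hab x x.2]; simp
      | add x y hx hy => rw [map_add, map_add, ← hx, ← hy, ← map_add]; rfl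
    rw [this, hy, map_zero]
  · intro x
    have : (⨆ a, gr a) ≤ (DirectSum.coeAddMonoidHom gr).range := iSup_le fun a y hy =>
      ⟨DirectSum.of (fun a => gr a) a ⟨y, hy⟩, DirectSum.coeAddMonoidHom_of gr a ⟨y, hy⟩⟩
    exact this (hsup x)

/-- A subgroup stable under the homogeneous projections inherits the grading. -/
lemma comap_of_injective (h : DirectSum.IsInternal gr) {N : Type*} [AddCommGroup N] (j : N →+ M)
    (hj : Function.Injective j) (hproj : ∀ a x, ∃ y, h.proj a (j x) = j y) :
    DirectSum.IsInternal fun a => (gr a).comap j := by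
  refine of_detect (fun x => ?_) (fun a => (h.proj a).comp j)
    (fun a b hab x hx => h.proj_of_mem_ne hab hx)
    (fun a x hx hx0 => hj (by
      rw [map_zero, ← hx0, AddMonoidHom.comp_apply, h.proj_of_mem hx]))
  choose y hy using hproj
  obtain ⟨F, hF⟩ := h.exists_sum_proj (j x)
  have : x = ∑ a ∈ F, y a x := hj (by
    rw [map_sum]
    exact (hF F subset_rfl).symm.trans (Finset.sum_congr rfl fun a _ => hy a x))
  rw [this]
  refine sum_mem fun a _ => AddSubgroup.mem_iSup_of_mem a ?_
  rw [AddSubgroup.mem_comap, ← hy]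
  exact h.proj_mem _ _

/-- The grading of a tensor product of graded modules over a graded ring. -/
lemma tensorProduct {Γ : Type*} [DecidableEq Γ] [AddCommGroup Γ] {R S N : Type*} [CommRing R]
    [AddCommGroup S] [Module R S] [AddCommGroup N] [Module R N] {𝓡 : Γ → AddSubgroup R}
    {𝓢 : Γ → AddSubgroup S} {𝓝 : Γ → AddSubgroup N} (hR : DirectSum.IsInternal 𝓡)
    (hS : DirectSum.IsInternal 𝓢) (hN : DirectSum.IsInternal 𝓝)
    (hRS : ∀ c d, ∀ r ∈ 𝓡 c, ∀ s ∈ 𝓢 d, r • s ∈ 𝓢 (c + d))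
    (hRN : ∀ c d, ∀ r ∈ 𝓡 c, ∀ s ∈ 𝓝 d, r • s ∈ 𝓝 (c + d)) :
    DirectSum.IsInternal fun a : Γ => AddSubgroup.closure {x : S ⊗[R] N |
      ∃ c b, c + b = a ∧ ∃ s ∈ 𝓢 c, ∃ n ∈ 𝓝 b, x = s ⊗ₜ n} := by
  -- The projection to degree `a` sends `s ⊗ n`, with `s` of degree `c`, to `s ⊗ n'`, where `n'` is
  -- the component of `n` of degree `a - c`.
  have hB : ∀ a, ∃ B : S →+ N →+ S ⊗[R] N, ∀ c, ∀ s ∈ 𝓢 c, ∀ n,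
      B s n = s ⊗ₜ hN.proj (-c + a) n := fun a => by
    obtain ⟨B, hB⟩ := hS.exists_lift fun c => AddMonoidHom.mk' (G := N →+ S ⊗[R] N)
      (fun s : 𝓢 c => (TensorProduct.mk R S N s).toAddMonoidHom.comp (hN.proj (-c + a)))
      (fun s t => by ext n; simp)
    exact ⟨B, fun c s hs n => by rw [hB c s hs]; rfl⟩
  choose B hB using hB
  -- For homogeneous `r` of degree `d`, both sides select the same component of `n`, since
  -- multiplication by `r` shifts degrees by `d`.
  have hbal : ∀ a (r : R) (s : S) (n : N), B a (r • s) n = B a s (r • n) := by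
    intro a r s n
    induction r using hR.induction with
    | zero => simp
    | add r t hr ht => simp only [add_smul, map_add, AddMonoidHom.add_apply, hr, ht]
    | mem d r hr =>
      induction s using hS.induction with
      | zero => simp
      | add r t hr ht => simp only [smul_add, map_add, AddMonoidHom.add_apply, hr, ht]
      | mem c s hs =>
        rw [hB a _ _ (hRS d c r hr s hs), hB a _ _ hs, TensorProduct.smul_tmul]
        congr 1
        have := hN.proj_map hN (DistribSMul.toAddMonoidHom N r) (add_right_injective d)
          (fun b x hx => hRN d b r hr x hx) (-(d + c) + a) n
        rw [DistribSMul.toAddMonoidHom_apply, DistribSMul.toAddMonoidHom_apply] at this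
        rw [← this]
        congr 2
        abel
  let π : Γ → S ⊗[R] N →+ S ⊗[R] N := fun a => TensorProduct.liftAddHom (B a) (hbal a)
  refine of_detect (fun x => ?_) π (fun a b hab x hx => ?_) (fun a x hx hx0 => ?_)
  · induction x using TensorProduct.induction_on with
    | zero => exact zero_mem _
    | add x y hx hy => exact add_mem hx hy
    | tmul s n =>
      induction s using hS.induction with
      | zero => rw [TensorProduct.zero_tmul]; exact zero_mem _
      | add s t hs ht => rw [TensorProduct.add_tmul]; exact add_mem hs ht
      | mem c s hs =>
        induction n using hN.induction with
        | zero => rw [TensorProduct.tmul_zero]; exact zero_mem _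
        | add s t hs ht => rw [TensorProduct.tmul_add]; exact add_mem hs ht
        | mem b n hn =>
          exact AddSubgroup.mem_iSup_of_mem (c + b)
            (AddSubgroup.subset_closure ⟨c, b, rfl, s, hs, n, hn, rfl⟩)
  · induction hx using AddSubgroup.closure_induction with
    | zero => simp
    | add x y _ _ hx hy => rw [map_add, hx, hy, add_zero]
    | neg x _ hx => rw [map_neg, hx, neg_zero]
    | mem x hx =>
      obtain ⟨c, d, rfl, s, hs, n, hn, rfl⟩ := hx
      rw [TensorProduct.liftAddHom_tmul, hB a c s hs, hN.proj_of_mem_ne _ hn,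
        TensorProduct.tmul_zero]
      exact fun h => hab (by rw [← h, add_neg_cancel_left])
  · have : π a x = x := by
      clear hx0
      induction hx using AddSubgroup.closure_induction with
      | zero => simp
      | add x y _ _ hx hy => rw [map_add, hx, hy]
      | neg x _ hx => rw [map_neg, hx]
      | mem x hx =>
        obtain ⟨c, d, rfl, s, hs, n, hn, rfl⟩ := hx
        rw [TensorProduct.liftAddHom_tmul, hB _ c s hs, neg_add_cancel_left, hN.proj_of_mem hn]
    rw [← this, hx0]

/-- The grading of the dual of a finitely generated graded module over a graded ring. -/
lemma dual {Γ : Type*} [DecidableEq Γ] [AddCommGroup Γ] {S M : Type*} [CommRing S]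
    [AddCommGroup M] [Module S M] [Module.Finite S M] {𝓢 : Γ → AddSubgroup S}
    {𝓜 : Γ → AddSubgroup M} (hS : DirectSum.IsInternal 𝓢) (hM : DirectSum.IsInternal 𝓜)
    (hSS : ∀ c d, ∀ r ∈ 𝓢 c, ∀ s ∈ 𝓢 d, r * s ∈ 𝓢 (c + d))
    (hSM : ∀ c d, ∀ r ∈ 𝓢 c, ∀ m ∈ 𝓜 d, r • m ∈ 𝓜 (c + d))
    {𝓓 : Γ → AddSubgroup (Module.Dual S M)}
    (hD : ∀ a φ, φ ∈ 𝓓 a ↔ ∀ b, ∀ m ∈ 𝓜 b, φ m ∈ 𝓢 (a + b)) :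
    DirectSum.IsInternal 𝓓 := by
  -- To detect degree `a` it suffices to record, for each `m` of degree `b`, the component of `φ m`
  -- of degree `a + b`.
  refine of_detect (fun φ => ?_) (P := ∀ b, 𝓜 b → S)
    (fun a => AddMonoidHom.mk' (fun φ b m => hS.proj (a + b) (φ m))
      (fun φ ψ => by ext b m; simp))
    (fun a a' haa x hx => ?_) (fun a x hx hx0 => ?_)
  · have hφ : ∀ a, ∃ φ' : Module.Dual S M, ∀ b, ∀ m ∈ 𝓜 b, φ' m = hS.proj (a + b) (φ m) := by
      intro a
      obtain ⟨F, hF⟩ := hM.exists_lift fun b =>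
        ((hS.proj (a + b)).comp φ.toAddMonoidHom).comp (𝓜 b).subtype
      refine ⟨{ toFun := F, map_add' := map_add F, map_smul' := fun s m => ?_ }, hF⟩
      rw [RingHom.id_apply]
      induction s using hS.induction with
      | zero => simp
      | add s t hs ht => simp only [add_smul, map_add, hs, ht]
      | mem c s hs =>
        induction m using hM.induction with
        | zero => simp
        | add s t hs ht => simp only [smul_add, map_add, hs, ht]
        | mem b m hm =>
          rw [hF (c + b) _ (hSM c b s hs m hm), hF b m hm]
          change hS.proj (a + (c + b)) (φ (s • m)) = s • hS.proj (a + b) (φ m)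
          rw [map_smul, add_left_comm]
          exact hS.proj_map hS (DistribSMul.toAddMonoidHom S s) (add_right_injective c)
            (fun d x hx => hSS c d s hs x hx) (a + b) (φ m)
    choose φ' hφ' using hφ
    have hsum : ∀ m, ∃ F : Finset Γ, ∀ F', F ⊆ F' → ∑ a ∈ F', φ' a m = φ m := fun m => by
      induction m using hM.induction with
      | zero => exact ⟨∅, fun F' _ => by simp⟩
      | add x y hx hy =>
        obtain ⟨F, hF⟩ := hx
        obtain ⟨F₁, hF₁⟩ := hy
        refine ⟨F ∪ F₁, fun F' hF' => ?_⟩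
        simp_rw [map_add]
        rw [Finset.sum_add_distrib, hF F' (Finset.union_subset_left hF'),
          hF₁ F' (Finset.union_subset_right hF')]
      | mem b m hm =>
        obtain ⟨F, hF⟩ := hS.exists_sum_proj (φ m)
        -- For `m` of degree `b`, `φ' a m` is the component of `φ m` of degree `a + b`, so the index
        -- set is shifted by `b`.
        refine ⟨F.image (· - b), fun F' hF' => ?_⟩
        have h1 : F ⊆ F'.image (· + b) := fun c hc => Finset.mem_image.2
          ⟨c - b, hF' (Finset.mem_image_of_mem _ hc), sub_add_cancel c b⟩
        rw [← hF _ h1, Finset.sum_image fun x _ y _ h => add_right_cancel h]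
        exact Finset.sum_congr rfl fun a _ => hφ' a b m hm
    choose F hF using hsum
    -- Finite generation enters here: one finite set of degrees serves all the generators, so `φ` is
    -- a finite sum of homogeneous forms.
    obtain ⟨X, hX⟩ := (inferInstance : Module.Finite S M).fg_top
    have : φ = ∑ a ∈ X.biUnion F, φ' a := by
      refine LinearMap.ext_on_range (v := ((↑) : X → M)) (by simpa using hX) fun m => ?_
      rw [LinearMap.sum_apply]
      exact (hF m _ (Finset.subset_biUnion_of_mem F m.2)).symm
    rw [this]
    refine sum_mem fun a _ => AddSubgroup.mem_iSup_of_mem a ((hD a _).2 fun b m hm => ?_)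
    rw [hφ' a b m hm]
    exact hS.proj_mem _ _
  · ext b m
    exact hS.proj_of_mem_ne (fun h => haa (add_right_cancel h)) ((hD a' x).1 hx b m m.2)
  · ext m
    induction m using hM.induction with
    | zero => simp
    | add x y hx hy => simpa using congrArg₂ (· + ·) hx hy
    | mem b m hm =>
      have := congrFun (congrFun hx0 b) ⟨m, hm⟩
      change hS.proj (a + b) (x m) = 0 at this
      rwa [hS.proj_of_mem ((hD a x).1 hx b m hm)] at this

end DirectSum.IsInternal

/-! ### The graded equivalence -/

open scoped Classical in
/-- A bijective morphism between graded modules is an isomorphism. -/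
lemma FamModule.isIso_of_bijective {Γ : Type*} {R : Type u} [CommRing R] {M N : FamModule R Γ}
    (hM : DirectSum.IsInternal M.gr) (hN : DirectSum.IsInternal N.gr) (f : M ⟶ N)
    (hf : Function.Bijective (FamModule.Hom.hom f)) : IsIso f := by
  let e := (LinearEquiv.ofBijective (FamModule.Hom.hom f).hom hf).toModuleIso
  let f' : N ⟶ M := ⟨e.inv, fun a n hn => hM.mem_of_map_mem hN
    (FamModule.Hom.hom f).hom.toAddMonoidHom hf.1 (FamModule.Hom.map_gr f) (by
      change (e.inv ≫ e.hom) n ∈ N.gr a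
      rw [e.inv_hom_id]
      exact hn)⟩
  exact ⟨f', FamModule.Hom.ext e.hom_inv_id, FamModule.Hom.ext e.inv_hom_id⟩

namespace FamGSModule

variable {G : Type v} {S : Type u} [Group G] [CommRing S] [MulSemiringAction G S]

open scoped Classical in
/-- The family of subgroups of `M` is a grading of the `(G, S)`-module `M`. -/
structure IsGraded {Γ : Type*} [AddCommGroup Γ] (𝓢 : Γ → AddSubgroup S)
    (M : FamGSModule G S Γ) : Prop where
  isInternal : DirectSum.IsInternal M.gr
  smul_mem : ∀ c d, ∀ s ∈ 𝓢 c, ∀ m ∈ M.gr d, s • m ∈ M.gr (c + d)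
  act_mem : ∀ (g : G) (a : Γ), ∀ m ∈ M.gr a, g • m ∈ M.gr a

variable {Γ : Type*} [AddCommGroup Γ] {𝓢 : Γ → AddSubgroup S}

lemma gradedReflexive_iff {M : FamGSModule G S Γ} :
    gradedReflexive 𝓢 M ↔ IsGraded 𝓢 M ∧ GSModule.reflexive G S M.mod :=
  ⟨fun ⟨h1, h2, h3, h4⟩ => ⟨⟨h1, fun _ _ _ hs _ hm => h2.smul_mem hs hm, h3⟩, h4⟩,
    fun ⟨⟨h1, h2, h3⟩, h4⟩ => ⟨h1, ⟨by intro c d s m hs hm; exact h2 c d s hs m hm⟩, h3, h4⟩⟩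

/-- The ring `S` as a `(G, S)`-module with a family of subgroups. -/
abbrev self (G : Type v) [Group G] [MulSemiringAction G S] (𝓢 : Γ → AddSubgroup S) :
    FamGSModule G S Γ where
  mod := ⟨S, fun g s m => smul_mul' g s m⟩
  gr := 𝓢

lemma IsGraded.dual (hS : IsGraded 𝓢 (self G 𝓢)) {M : FamGSModule G S Γ} (hM : IsGraded 𝓢 M)
    (hfin : Module.Finite S M.mod) : IsGraded 𝓢 (M.dual 𝓢) where
  isInternal := by
    classical
    exact DirectSum.IsInternal.dual (S := S) (M := M.mod) (𝓢 := 𝓢) (𝓜 := M.gr) (by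
      convert hS.isInternal) (by convert hM.isInternal) hS.smul_mem hM.smul_mem
      fun a φ => Iff.rfl
  smul_mem c d s hs φ hφ b m hm := by
    rw [add_assoc]
    exact hS.smul_mem _ _ s hs _ (hφ b m hm)
  act_mem g a φ hφ b m hm := hS.act_mem g _ _ (hφ b _ (hM.act_mem g⁻¹ b m hm))

-- Each `g` preserves degrees and hence commutes with the projections, so the components of an
-- invariant element are invariant.
open scoped Classical in
lemma IsGraded.isInternal_fixed {M : FamGSModule G S Γ} (hM : IsGraded 𝓢 M) :
    DirectSum.IsInternal ((invariants G S Γ).obj M).gr :=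
  hM.isInternal.comap_of_injective M.mod.fixed.subtype.toAddMonoidHom Subtype.val_injective
    fun a x => ⟨⟨hM.isInternal.proj a x.1, fun g => by
      refine (hM.isInternal.proj_map hM.isInternal (DistribSMul.toAddMonoidHom M.mod g)
        Function.injective_id (hM.act_mem g) a x.1).symm.trans ?_
      exact congrArg (hM.isInternal.proj a) (x.2 g)⟩, rfl⟩

variable (G 𝓢) in
/-- The induced grading of `S^G`. -/
abbrev fixedGrading (c : Γ) : AddSubgroup (FixedPoints.subring S G) :=
  (𝓢 c).comap (FixedPoints.subring S G).subtype.toAddMonoidHom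

open scoped Classical in
lemma IsGraded.isInternal_fixedGrading (hS : IsGraded 𝓢 (self G 𝓢)) :
    DirectSum.IsInternal (fixedGrading G 𝓢) :=
  hS.isInternal_fixed

lemma gradedReflexive_invariants [IsDomain S] [Finite G]
    [Module.Finite (FixedPoints.subring S G) S] (hG : IsUnit (Nat.card G : S))
    (hA : DetectsDvd (galoisElements G S)) {M : FamGSModule G S Γ} (hM : gradedReflexive 𝓢 M) :
    FamModule.gradedReflexive (fixedGrading G 𝓢) ((invariants G S Γ).obj M) := by
  obtain ⟨hM, h⟩ := gradedReflexive_iff.1 hM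
  exact ⟨hM.isInternal_fixed, ⟨by
    intro c d r m hr hm; exact hM.smul_mem c d r hr m.1 hm⟩,
    M.mod.finite_fixed hG h.1, M.mod.isReflexive_fixed hA h.2⟩

open scoped Classical in
lemma isGraded_baseChange (hS : IsGraded 𝓢 (self G 𝓢))
    {N : FamModule (FixedPoints.subring S G) Γ}
    (hN : FamModule.gradedReflexive (fixedGrading G 𝓢) N) : IsGraded 𝓢 (baseChange 𝓢 N) where
  isInternal := DirectSum.IsInternal.tensorProduct hS.isInternal_fixedGrading hS.isInternal hN.1
    (fun c d r hr s hs => hS.smul_mem c d r hr s hs) (fun c d r hr n hn => hN.2.1.smul_mem hr hn)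
  smul_mem c d s hs x hx := by
    suffices (baseChange 𝓢 N).gr d ≤ ((baseChange 𝓢 N).gr (c + d)).comap
      (DistribSMul.toAddMonoidHom (baseChange 𝓢 N).mod s) from this hx
    refine (AddSubgroup.closure_le _).2 ?_
    rintro _ ⟨e, b, rfl, t, ht, n, hn, rfl⟩
    exact AddSubgroup.subset_closure
      ⟨c + e, b, add_assoc _ _ _, s * t, hS.smul_mem _ _ _ hs _ ht, n, hn, rfl⟩
  act_mem g a x hx := by
    suffices (baseChange 𝓢 N).gr a ≤ ((baseChange 𝓢 N).gr a).comap
      (DistribSMul.toAddMonoidHom (baseChange 𝓢 N).mod g) from this hx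
    refine (AddSubgroup.closure_le _).2 ?_
    rintro _ ⟨e, b, rfl, t, ht, n, hn, rfl⟩
    exact AddSubgroup.subset_closure
      ⟨e, b, rfl, g • t, hS.act_mem _ _ _ ht, n, hn, TensorProduct.smul_tmul' g t n⟩

lemma gradedReflexive_extension [IsDomain S] [IsNoetherianRing S] (hS : IsGraded 𝓢 (self G 𝓢))
    {N : FamModule (FixedPoints.subring S G) Γ}
    (hN : FamModule.gradedReflexive (fixedGrading G 𝓢) N) :
    gradedReflexive 𝓢 ((extension 𝓢 ⋙ doubleDual 𝓢).obj N) := by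
  have h1 : Module.Finite S (GSModule.baseChange N.mod) :=
    GSModule.finite_baseChange N.mod hN.2.2.1
  have h2 : Module.Finite S (GSModule.baseChange N.mod).dual :=
    inferInstanceAs (Module.Finite S (Module.Dual S (GSModule.baseChange N.mod)))
  exact gradedReflexive_iff.2 ⟨hS.dual (hS.dual (isGraded_baseChange hS hN) h1) h2,
    (GSModule.baseChange N.mod).reflexive_doubleDual h1⟩

open scoped Classical in
/-- A bijective morphism between graded `(G, S)`-modules is an isomorphism. -/
lemma isIso_of_bijective {M N : FamGSModule G S Γ} (hM : IsGraded 𝓢 M) (hN : IsGraded 𝓢 N)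
    (f : M ⟶ N) (hf : Function.Bijective (GSModule.Hom.toLin (Hom.hom f))) : IsIso f := by
  let e := GSModule.isoOfBijective (Hom.hom f) hf
  let f' : N ⟶ M := ⟨e.inv, fun a n hn => hM.isInternal.mem_of_map_mem hN.isInternal
    (GSModule.Hom.toLin (Hom.hom f)).toAddMonoidHom hf.1 (Hom.map_gr f) (by
      change GSModule.Hom.toLin e.hom (GSModule.Hom.toLin e.inv n) ∈ N.gr a
      rw [← LinearMap.comp_apply, ← GSModule.comp_toLin, e.inv_hom_id]
      exact hn)⟩
  exact ⟨f', Hom.ext e.hom_inv_id, Hom.ext e.inv_hom_id⟩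

variable (G 𝓢) in
/-- The maps `M → M**` preserve degrees. -/
def evalNatTrans : 𝟭 (FamGSModule G S Γ) ⟶ doubleDual 𝓢 where
  app M :=
    { hom := M.mod.evalMap
      map_gr := fun a m hm b φ hφ => by
        rw [add_comm]
        exact hφ a m hm }
  naturality _ _ _ := rfl

variable (G 𝓢) in
/-- The maps `S ⊗_R M^G → M` preserve degrees if `M` is graded. -/
def actionNatTrans : (gradedReflexive (G := G) 𝓢).ι ⋙ invariants G S Γ ⋙ extension 𝓢 ⟶
    (gradedReflexive (G := G) 𝓢).ι where
  app M :=
    { hom := M.obj.mod.actionMap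
      map_gr := fun a x hx => by
        suffices ((invariants G S Γ ⋙ extension 𝓢).obj M.obj).gr a ≤ (M.obj.gr a).comap
          (GSModule.Hom.toLin M.obj.mod.actionMap).toAddMonoidHom from this hx
        refine (AddSubgroup.closure_le _).2 ?_
        rintro _ ⟨e, b, rfl, t, ht, n, hn, rfl⟩
        refine (congrArg (· ∈ M.obj.gr (e + b)) (M.obj.mod.actionMap_tmul t n)).mpr ?_
        exact (gradedReflexive_iff.1 M.property).1.smul_mem e b t ht n.1 hn }
  naturality _ _ f := Hom.ext ((GSModule.actionNatTrans G S).naturality f.hom.hom)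

/-- The maps `N → ((S ⊗_R N)**)^G` preserve degrees. -/
def toInvariantsNatTrans (h1 : (1 : S) ∈ 𝓢 0) :
    𝟭 (FamModule (FixedPoints.subring S G) Γ) ⟶
      (extension 𝓢 ⋙ doubleDual 𝓢) ⋙ invariants G S Γ where
  app N :=
    { hom := (GSModule.toInvariantsNatTrans G S).app N.mod
      map_gr := fun a n hn => by
        refine ((evalNatTrans G 𝓢).app (baseChange 𝓢 N)).map_gr a _ ?_
        exact AddSubgroup.subset_closure ⟨0, a, zero_add a, 1, h1, n, hn, rfl⟩ }
  naturality _ _ f := FamModule.Hom.ext ((GSModule.toInvariantsNatTrans G S).naturality f.hom)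

/-- The underlying maps are the ungraded ones, already known to be bijective. Since both ends are
graded, their inverses preserve degrees too. -/
theorem restrictToQuasiInverse [IsDomain S] [IsNoetherianRing S] [Finite G]
    [Module.Finite (FixedPoints.subring S G) S] (hG : IsUnit (Nat.card G : S))
    (hA : DetectsDvd (galoisElements G S)) (hS : IsGraded 𝓢 (self G 𝓢)) (h1 : (1 : S) ∈ 𝓢 0) :
    RestrictToQuasiInverse (gradedReflexive (G := G) 𝓢)
      (FamModule.gradedReflexive (fixedGrading G 𝓢)) (invariants G S Γ)
      (extension 𝓢 ⋙ doubleDual 𝓢) := by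
  have hdd : ∀ M : FamGSModule G S Γ, gradedReflexive 𝓢 M →
      IsGraded 𝓢 ((doubleDual 𝓢).obj M) := fun M hM => by
    obtain ⟨hM, h⟩ := gradedReflexive_iff.1 hM
    have h1 : Module.Finite S M.mod := h.1
    have h2 : Module.Finite S M.mod.dual :=
      inferInstanceAs (Module.Finite S (Module.Dual S M.mod))
    exact hS.dual (hS.dual hM h1) h2
  have hF : ∀ M : FamGSModule G S Γ, gradedReflexive 𝓢 M →
      FamModule.gradedReflexive (fixedGrading G 𝓢) ((invariants G S Γ).obj M) :=
    fun M hM => gradedReflexive_invariants hG hA hM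
  have hH : ∀ N : FamModule (FixedPoints.subring S G) Γ,
      FamModule.gradedReflexive (fixedGrading G 𝓢) N →
      gradedReflexive 𝓢 ((extension 𝓢 ⋙ doubleDual 𝓢).obj N) :=
    fun N hN => gradedReflexive_extension hS hN
  refine RestrictToQuasiInverse.of_natTrans (K := doubleDual 𝓢) hF hH
    (Functor.whiskerLeft (gradedReflexive 𝓢).ι (evalNatTrans G 𝓢)) (fun M => ?_)
    (Functor.whiskerRight (actionNatTrans G 𝓢) (doubleDual 𝓢)) (fun M => ?_)
    (Functor.whiskerLeft (FamModule.gradedReflexive (fixedGrading G 𝓢)).ι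
      (toInvariantsNatTrans h1)) (fun N => ?_)
  · have hM := gradedReflexive_iff.1 M.property
    exact isIso_of_bijective hM.1 (hdd _ M.property) ((evalNatTrans G 𝓢).app M.obj)
      hM.2.2.bijective_dual_eval'
  · exact isIso_of_bijective (gradedReflexive_iff.1 (hH _ (hF _ M.property))).1
      (hdd _ M.property) ((doubleDual 𝓢).map ((actionNatTrans G 𝓢).app M))
      (GSModule.bijective_doubleDual_actionMap hA M.obj.mod)
  · exact FamModule.isIso_of_bijective N.property.1 (hF _ (hH _ N.property)).1
      ((toInvariantsNatTrans h1).app N.obj)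
      (GSModule.bijective_toInvariants hA N.obj.mod N.property.2.2.2)

end FamGSModule

/-! ### Sets that detect divisibility -/

lemma DetectsDvd.mono {S : Type*} [CommRing S] {A B : Set S} (hA : DetectsDvd A) (h : A ⊆ B) :
    DetectsDvd B := fun x y hxy => hA x y fun a ha => hxy a (h ha)

/-- One factor is removed at a time: if `y ∣ p b x` for all products `p` of the other factors, then
`y ∣ b x`, after which `b` varies. This is the counterpart of a product of ideals of height at least
two having height at least two. -/
lemma DetectsDvd.prod {S : Type*} [CommRing S] {ι : Type*} (I : Finset ι) (B : ι → Set S)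
    (hB : ∀ i ∈ I, DetectsDvd (B i)) :
    DetectsDvd {a : S | ∃ f : ι → S, (∀ i ∈ I, f i ∈ B i) ∧ a = ∏ i ∈ I, f i} := by
  classical
  induction I using Finset.induction_on with
  | empty => exact fun x y h => by simpa using h 1 ⟨1, by simp⟩
  | insert i I hi ih =>
    intro x y h
    refine hB i (Finset.mem_insert_self i I) x y fun b hb => ?_
    refine ih (fun j hj => hB j (Finset.mem_insert_of_mem hj)) _ y ?_
    rintro _ ⟨f, hf, rfl⟩
    have := h (b * ∏ j ∈ I, f j) ⟨Function.update f i b, fun j hj => ?_, ?_⟩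
    · rwa [mul_comm b, mul_assoc] at this
    · obtain rfl | hj := Finset.mem_insert.1 hj
      · simpa using hb
      · rw [Function.update_of_ne (ne_of_mem_of_not_mem hj hi)]
        exact hf j hj
    · rw [Finset.prod_insert hi, Function.update_self]
      congr 1
      exact Finset.prod_congr rfl fun j hj => by
        rw [Function.update_of_ne (ne_of_mem_of_not_mem hj hi)]

/-- From `l x = y u` and `l' x = y w` follows `l' u = l w` when `y ≠ 0`. Hence `l ∣ u`, and
cancelling `l` gives `y ∣ x`. -/
lemma DetectsDvd.of_prime {S : Type*} [CommRing S] [IsDomain S] {A : Set S} {l l' : S}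
    (hl : l ∈ A) (hl' : l' ∈ A) (hprime : Prime l) (hdvd : ¬ l ∣ l') : DetectsDvd A := by
  intro x y h
  obtain ⟨u, hu⟩ := h l hl
  obtain ⟨w, hw⟩ := h l' hl'
  by_cases hy : y = 0
  · subst hy
    rw [zero_mul] at hu
    rw [(mul_eq_zero.1 hu).resolve_left hprime.ne_zero]
  · have h1 : l' * u = l * w := mul_left_cancel₀ hy (by
      rw [mul_left_comm, ← hu, mul_left_comm y, ← hw, mul_left_comm])
    obtain ⟨t, rfl⟩ := (hprime.dvd_or_dvd (Dvd.intro w h1.symm)).resolve_left hdvd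
    exact ⟨t, mul_left_cancel₀ hprime.ne_zero (by rw [hu, mul_left_comm])⟩

/-- The tensor is the product over `g ≠ 1` of `(g u_g) ⊗ 1 - 1 ⊗ u_g`. The ring map `s ⊗ t ↦ s (h
t)` sends it to the product of the `g u_g - h u_g`, whose factor at `g = h` vanishes when `h ≠ 1`.
-/
lemma prod_mem_galoisElements {G S : Type*} [Group G] [Fintype G] [DecidableEq G] [CommRing S]
    [MulSemiringAction G S] (f : G → S) (hf : ∀ g ≠ 1, ∃ u : S, f g = g • u - u) :
    ∏ g ∈ Finset.univ.erase 1, f g ∈ galoisElements G S := by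
  choose! u hu using hf
  let ev : G → S ⊗[ℤ] S →ₐ[ℤ] S := fun h =>
    Algebra.TensorProduct.productMap (AlgHom.id ℤ S) (MulSemiringAction.toRingHom G S h).toIntAlgHom
  have hev : ∀ h (s t : S), ev h (s ⊗ₜ t) = s * h • t := fun h s t =>
    Algebra.TensorProduct.productMap_apply_tmul _ _ s t
  obtain ⟨F, hF⟩ := TensorProduct.exists_finset
    (∏ g ∈ Finset.univ.erase (1 : G), ((g • u g) ⊗ₜ[ℤ] (1 : S) - (1 : S) ⊗ₜ[ℤ] u g))
  have key : ∀ h, ∑ i ∈ F, i.1 * h • i.2 = ∏ g ∈ Finset.univ.erase (1 : G), (g • u g - h • u g) :=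
    fun h => by
      have := congrArg (ev h) hF
      rw [map_prod, map_sum] at this
      simp only [map_sub, hev, smul_one, mul_one, one_mul] at this
      exact this.symm
  refine ⟨F, ?_, fun g hg => ?_⟩
  · have := key 1
    simp only [one_smul] at this
    rw [this]
    exact Finset.prod_congr rfl fun g hg => (hu g (Finset.ne_of_mem_erase hg)).symm
  · rw [key]
    exact Finset.prod_eq_zero (Finset.mem_erase.2 ⟨hg, Finset.mem_univ g⟩) (sub_self _)

/-! ### The symmetric algebra -/

namespace SymmetricAlgebra

variable {k : Type u} {V : Type v} [Field k] [AddCommGroup V] [Module k V]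

lemma gl_smul_ι (g : LinearMap.GeneralLinearGroup k V) (x : V) :
    g • ι k V x = ι k V ((g : V →ₗ[k] V) x) :=
  SymmetricAlgebra.lift_ι_apply ..

lemma gl_smul_algebraMap (g : LinearMap.GeneralLinearGroup k V) (r : k) :
    g • algebraMap k (SymmetricAlgebra k V) r = algebraMap k _ r :=
  AlgHom.commutes (SymmetricAlgebra.lift (SymmetricAlgebra.ι k V ∘ₗ (g : V →ₗ[k] V))) r

/-- Once `x` and `y` are extended to a basis of `V`, they become two distinct variables of a
polynomial ring. -/
lemma prime_ι_and_not_dvd {x y : V} (h : LinearIndependent k ![x, y]) :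
    Prime (ι k V x) ∧ ¬ ι k V x ∣ ι k V y := by
  have hs : LinearIndepOn k id (Set.range ![x, y]) := h.linearIndepOn_id
  let b := Module.Basis.extend hs
  have hsub := Module.Basis.subset_extend hs
  let i : hs.extend (Set.subset_univ _) := ⟨x, hsub ⟨0, rfl⟩⟩
  let j : hs.extend (Set.subset_univ _) := ⟨y, hsub ⟨1, rfl⟩⟩
  have hi : equivMvPolynomial b (ι k V x) = MvPolynomial.X i := by
    rw [← equivMvPolynomial_ι_apply b i, Module.Basis.extend_apply_self]
  have hj : equivMvPolynomial b (ι k V y) = MvPolynomial.X j := by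
    rw [← equivMvPolynomial_ι_apply b j, Module.Basis.extend_apply_self]
  have hij : i ≠ j := fun e => by
    have : (0 : Fin 2) = 1 := h.injective (congrArg Subtype.val e)
    exact absurd this (by decide)
  constructor
  · rw [← MulEquiv.prime_iff (equivMvPolynomial b), hi]
    exact MvPolynomial.X_prime
  · intro hd
    have := map_dvd (equivMvPolynomial b) hd
    rw [hi, hj, MvPolynomial.X_dvd_X] at this
    exact hij this

instance isNoetherianRing [FiniteDimensional k V] : IsNoetherianRing (SymmetricAlgebra k V) :=
  isNoetherianRing_of_ringEquiv _
    (equivMvPolynomial (Module.finBasis k V)).symm.toRingEquiv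

variable (G : Subgroup (LinearMap.GeneralLinearGroup k V))

/-- `S` is integral over its invariants, and of finite type over them because `k` lies in `R`. -/
lemma finite_fixedPoints [FiniteDimensional k V] [Finite G] :
    Module.Finite (FixedPoints.subring (SymmetricAlgebra k V) G) (SymmetricAlgebra k V) := by
  have h1 : Algebra.IsInvariant (FixedPoints.subring (SymmetricAlgebra k V) G)
      (SymmetricAlgebra k V) G := ⟨fun b hb => ⟨⟨b, hb⟩, rfl⟩⟩
  have h2 := Algebra.IsInvariant.isIntegral (FixedPoints.subring (SymmetricAlgebra k V) G)
    (SymmetricAlgebra k V) G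
  have h3 : (algebraMap k (SymmetricAlgebra k V)).FiniteType :=
    (RingHom.finiteType_algebraMap).2 (Algebra.FiniteType.equiv inferInstance
      (equivMvPolynomial (Module.finBasis k V)).symm)
  let f : k →+* FixedPoints.subring (SymmetricAlgebra k V) G :=
    (algebraMap k (SymmetricAlgebra k V)).codRestrict _ fun r g =>
      gl_smul_algebraMap (g : LinearMap.GeneralLinearGroup k V) r
  have h4 : (algebraMap (FixedPoints.subring (SymmetricAlgebra k V) G)
      (SymmetricAlgebra k V)).FiniteType := RingHom.FiniteType.of_comp_finiteType (f := f) h3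
  have h5 : Algebra.FiniteType (FixedPoints.subring (SymmetricAlgebra k V) G)
      (SymmetricAlgebra k V) := RingHom.finiteType_algebraMap.1 h4
  exact Algebra.IsIntegral.finite

/-- If `G` contains no pseudo-reflections, then the elements of `galoisElements` generate an ideal
of height at least two. -/
lemma detectsDvd_galoisElements [FiniteDimensional k V] [Finite G]
    (hG : ∀ g ∈ G, ¬ IsPseudoReflection g) :
    DetectsDvd (galoisElements G (SymmetricAlgebra k V)) := by
  classical
  cases nonempty_fintype G
  refine (DetectsDvd.prod (Finset.univ.erase (1 : G))
    (fun g => {a | ∃ u : SymmetricAlgebra k V, a = g • u - u}) fun g hg => ?_).mono ?_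
  -- The rank of `g - 1` is nonzero as `g ≠ 1`, and is not one as `g` is no pseudo-reflection. Its
  -- image therefore contains two independent vectors, each giving a difference `g u - u`.
  · let T : V →ₗ[k] V := ((g : LinearMap.GeneralLinearGroup k V) : V →ₗ[k] V) - LinearMap.id
    have h0 : Module.finrank k (LinearMap.range T) ≠ 0 := fun h => by
      have hT : T = 0 := LinearMap.range_eq_bot.1 (Submodule.finrank_eq_zero.1 h)
      exact Finset.ne_of_mem_erase hg (Subtype.ext (Units.ext (sub_eq_zero.1 hT)))
    have h1 : Module.finrank k (LinearMap.range T) ≠ 1 := hG g g.2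
    have hne : Nontrivial (LinearMap.range T) :=
      Module.nontrivial_of_finrank_pos (Nat.pos_of_ne_zero h0)
    obtain ⟨x, hx⟩ := exists_ne (0 : LinearMap.range T)
    obtain ⟨y, hxy⟩ := exists_linearIndependent_pair_of_one_lt_finrank (R := k)
      (show 1 < Module.finrank k (LinearMap.range T) by omega) hx
    have hxy' : LinearIndependent k ![(x : V), (y : V)] := by
      rw [LinearIndependent.pair_iff] at hxy ⊢
      exact fun r t h => hxy r t (Subtype.ext h)
    have hmem : ∀ x : LinearMap.range T, ∃ u : SymmetricAlgebra k V, ι k V x = g • u - u := by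
      rintro ⟨_, v, rfl⟩
      refine ⟨ι k V v, ?_⟩
      rw [show g • ι k V v = _ from gl_smul_ι (g : LinearMap.GeneralLinearGroup k V) v,
        ← map_sub]
      rfl
    obtain ⟨hp, hd⟩ := prime_ι_and_not_dvd hxy'
    exact DetectsDvd.of_prime (hmem x) (hmem y) hp hd
  · rintro _ ⟨f, hf, rfl⟩
    exact prod_mem_galoisElements f fun g hg => hf g (Finset.mem_erase.2 ⟨hg, Finset.mem_univ g⟩)

/-! ### The standard grading of the symmetric algebra -/

lemma mem_range_ι_pow {κ : Type*} (b : Module.Basis κ k V) (i : ℕ) (s : SymmetricAlgebra k V) :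
    s ∈ LinearMap.range (ι k V) ^ i ↔
      equivMvPolynomial b s ∈ MvPolynomial.homogeneousSubmodule κ k i := by
  have h1 : (LinearMap.range (ι k V)).map (equivMvPolynomial b).toAlgHom.toLinearMap =
      MvPolynomial.homogeneousSubmodule κ k 1 := by
    rw [MvPolynomial.homogeneousSubmodule_one_eq_span_X, LinearMap.range_eq_map, ← b.span_eq,
      Submodule.map_span, Submodule.map_span, ← Set.range_comp, ← Set.range_comp]
    congr 2
    ext1 j
    exact equivMvPolynomial_ι_apply b j
  rw [← MvPolynomial.homogeneousSubmodule_one_pow, ← h1, ← Submodule.map_pow]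
  refine ⟨fun hs => Submodule.mem_map_of_mem hs, ?_⟩
  rintro ⟨t, ht, h⟩
  exact (equivMvPolynomial b).injective h ▸ ht

variable {Γ : Type*} [Ring Γ]

lemma mem_grading_of_mem_pow {i : ℕ} {s : SymmetricAlgebra k V}
    (hs : s ∈ LinearMap.range (ι k V) ^ i) : s ∈ grading k V Γ i :=
  AddSubgroup.mem_iSup_of_mem i (AddSubgroup.mem_iSup_of_mem rfl hs)

lemma grading_le {c : Γ} {H : AddSubgroup (SymmetricAlgebra k V)}
    (h : ∀ i : ℕ, (i : Γ) = c → ∀ s ∈ LinearMap.range (ι k V) ^ i, s ∈ H) :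
    grading k V Γ c ≤ H := iSup₂_le h

lemma one_mem_grading : (1 : SymmetricAlgebra k V) ∈ grading k V Γ 0 := by
  have := mem_grading_of_mem_pow (Γ := Γ) (i := 0) (s := (1 : SymmetricAlgebra k V))
    (by rw [pow_zero]; exact Submodule.one_le.1 le_rfl)
  rwa [Nat.cast_zero] at this

lemma mul_mem_grading {c d : Γ} {r s : SymmetricAlgebra k V} (hr : r ∈ grading k V Γ c)
    (hs : s ∈ grading k V Γ d) : r * s ∈ grading k V Γ (c + d) := by
  suffices grading k V Γ c ≤ (grading k V Γ (c + d)).comap (AddMonoidHom.mulRight s) from this hr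
  refine grading_le fun i hi r hr' => ?_
  suffices grading k V Γ d ≤ (grading k V Γ (c + d)).comap (AddMonoidHom.mulLeft r) from this hs
  refine grading_le fun j hj s hs' => ?_
  subst hi hj
  rw [← Nat.cast_add]
  exact mem_grading_of_mem_pow (by rw [pow_add]; exact Submodule.mul_mem_mul hr' hs')

lemma gl_smul_mem_grading (g : LinearMap.GeneralLinearGroup k V) {c : Γ}
    {s : SymmetricAlgebra k V} (hs : s ∈ grading k V Γ c) : g • s ∈ grading k V Γ c := by
  suffices grading k V Γ c ≤ (grading k V Γ c).comap
    (DistribSMul.toAddMonoidHom (SymmetricAlgebra k V) g) from this hs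
  refine grading_le fun i hi s hs' => ?_
  subst hi
  refine mem_grading_of_mem_pow ?_
  let F := SymmetricAlgebra.lift (SymmetricAlgebra.ι k V ∘ₗ (g : V →ₗ[k] V))
  have h1 : (LinearMap.range (ι k V)).map F.toLinearMap ≤ LinearMap.range (ι k V) := by
    rintro _ ⟨_, ⟨v, rfl⟩, rfl⟩
    exact ⟨(g : V →ₗ[k] V) v, (gl_smul_ι g v).symm⟩
  have h2 := Submodule.mem_map_of_mem (f := F.toLinearMap) hs'
  rw [Submodule.map_pow] at h2
  exact pow_le_pow_left' h1 i h2

open scoped Classical in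
lemma isInternal_grading [CharZero Γ] : DirectSum.IsInternal (grading k V Γ) := by
  obtain ⟨κ, b⟩ := Module.Free.exists_basis (R := k) (M := V)
  let e := equivMvPolynomial b
  -- In characteristic zero at most one natural number `i` maps to `c`, so the choice is harmless.
  -- When there is none, the component of degree `c` is zero, and so is the detecting map.
  let π : Γ → SymmetricAlgebra k V →+ MvPolynomial κ k := fun c =>
    if h : ∃ i : ℕ, (i : Γ) = c then
      (MvPolynomial.homogeneousComponent h.choose).toAddMonoidHom.comp e.toAddMonoidHom else 0
  have hπ : ∀ i : ℕ, π i =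
      (MvPolynomial.homogeneousComponent i).toAddMonoidHom.comp e.toAddMonoidHom := fun i => by
    have h : ∃ j : ℕ, (j : Γ) = i := ⟨i, rfl⟩
    have h' : h.choose = i := Nat.cast_injective h.choose_spec
    simp only [π, dif_pos h, h']
  have hπ' : ∀ c : Γ, (¬ ∃ i : ℕ, (i : Γ) = c) → π c = 0 := fun c h => dif_neg h
  refine DirectSum.IsInternal.of_detect (fun s => ?_) π (fun a c hac s hs => ?_)
    (fun a s hs hs0 => ?_)
  · have h1 : s = ∑ i ∈ Finset.range ((e s).totalDegree + 1),
        e.symm (MvPolynomial.homogeneousComponent i (e s)) := by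
      rw [← map_sum, MvPolynomial.sum_homogeneousComponent, e.symm_apply_apply]
    rw [h1]
    refine sum_mem fun i _ => AddSubgroup.mem_iSup_of_mem (i : Γ) (mem_grading_of_mem_pow ?_)
    rw [mem_range_ι_pow b, AlgEquiv.apply_symm_apply]
    exact MvPolynomial.homogeneousComponent_mem i _
  · by_cases ha : ∃ i : ℕ, (i : Γ) = a
    · obtain ⟨i, rfl⟩ := ha
      suffices grading k V Γ c ≤ (π i).ker from this hs
      refine grading_le fun j hj s hs => ?_
      rw [AddMonoidHom.mem_ker, hπ]
      refine (MvPolynomial.homogeneousComponent_of_mem ((mem_range_ι_pow b j s).1 hs)).trans ?_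
      rw [if_neg]
      rintro rfl
      exact hac hj
    · rw [hπ' a ha]; rfl
  · by_cases ha : ∃ i : ℕ, (i : Γ) = a
    · obtain ⟨i, rfl⟩ := ha
      have hs' : s ∈ LinearMap.range (ι k V) ^ i := by
        suffices grading k V Γ i ≤ (LinearMap.range (ι k V) ^ i).toAddSubgroup from this hs
        refine grading_le fun j hj s hs => ?_
        rw [Nat.cast_inj] at hj
        exact hj ▸ hs
      rw [hπ] at hs0
      have h1 := MvPolynomial.homogeneousComponent_of_mem (m := i) ((mem_range_ι_pow b i s).1 hs')
      rw [if_pos rfl] at h1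
      exact e.injective ((h1.symm.trans hs0).trans (map_zero e).symm)
    · have : grading k V Γ a ≤ ⊥ := grading_le fun j hj => (ha ⟨j, hj⟩).elim
      exact this hs

end SymmetricAlgebra

end

/-! ### The theorem for the symmetric algebra -/

theorem mainTheorem5 {k : Type u} [Field k] [IsAlgClosed k] (p : ℕ) [Fact p.Prime] [CharP k p]
    {V : Type v} [AddCommGroup V] [Module k V] [FiniteDimensional k V]
    (G : Subgroup (LinearMap.GeneralLinearGroup k V)) [Finite G]
    (hp : ¬ p ∣ Nat.card G) (hG : ∀ g ∈ G, ¬ IsPseudoReflection g) :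
    RestrictToQuasiInverse
      (GSModule.reflexive G (SymmetricAlgebra k V))
      (reflexiveModules (FixedPoints.subring (SymmetricAlgebra k V) G))
      (GSModule.invariants G (SymmetricAlgebra k V))
      (GSModule.extension G (SymmetricAlgebra k V) ⋙
        GSModule.doubleDual G (SymmetricAlgebra k V)) ∧
    RestrictToQuasiInverse
      (FamGSModule.gradedReflexive (G := G)
        (SymmetricAlgebra.grading k V (Localization.Away (p : ℤ))))
      (FamModule.gradedReflexive fun c : Localization.Away (p : ℤ) =>
        (SymmetricAlgebra.grading k V (Localization.Away (p : ℤ)) c).comap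
          (FixedPoints.subring (SymmetricAlgebra k V) G).subtype.toAddMonoidHom)
      (FamGSModule.invariants G (SymmetricAlgebra k V) (Localization.Away (p : ℤ)))
      (FamGSModule.extension (SymmetricAlgebra.grading k V (Localization.Away (p : ℤ))) ⋙
        FamGSModule.doubleDual (SymmetricAlgebra.grading k V (Localization.Away (p : ℤ)))) := by
  have hfin := SymmetricAlgebra.finite_fixedPoints G
  have hunit : IsUnit (Nat.card G : SymmetricAlgebra k V) := by
    have h : (Nat.card G : k) ≠ 0 := fun h => hp ((CharP.cast_eq_zero_iff k p _).1 h)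
    rw [← map_natCast (algebraMap k (SymmetricAlgebra k V))]
    exact (IsUnit.mk0 _ h).map _
  have hA := SymmetricAlgebra.detectsDvd_galoisElements G hG
  -- Powers of `p` are nonzero integers, so `ℤ` embeds in `ℤ[1/p]` and distinct natural degrees stay
  -- distinct.
  have hΓ : CharZero (Localization.Away (p : ℤ)) :=
    charZero_of_injective_algebraMap (R := ℤ) (IsLocalization.injective _
      (Submonoid.powers_le.2 (mem_nonZeroDivisors_of_ne_zero
        (Int.natCast_ne_zero.2 (Fact.out : p.Prime).ne_zero))))
  exact ⟨GSModule.restrictToQuasiInverse hunit hA,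
    FamGSModule.restrictToQuasiInverse hunit hA
      { isInternal := SymmetricAlgebra.isInternal_grading
        smul_mem := fun c d r hr s hs => SymmetricAlgebra.mul_mem_grading hr hs
        act_mem := fun g a s hs =>
          SymmetricAlgebra.gl_smul_mem_grading (g : LinearMap.GeneralLinearGroup k V) hs }
      SymmetricAlgebra.one_mem_grading⟩
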